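/- For a finite simple graph $G=(V,E)$ write $n=|V|$ and let $\beta$ be its clique number, i.e. the size of a largest clique of $G$. In the problem Link Respected Clique Cover (LRCC) the input is a finite simple graph $G=(V,E)$, an integer $k\ge 0$ and a set of edges $E^*\subseteq E$. The output is, if one exists, a set $\mathcal C$ of cliques of $G$ such that (1) $|\mathcal C|\le k$, (2) every vertex of $G$ is contained in at least one clique of $\mathcal C$, and (3) for every edge $\{x,y\}\in E^*$ at least one clique of $\mathcal C$ contains both $x$ and $y$; if no such set exists, the output is NO. Theorem. LRCC, parameterized by $\beta$ and $k$, has a fixed-parameter tractable algorithm running in $2^{\beta k\log k}\,n^{O(1)}$ time. That is, there are a deterministic algorithm (a program of a random access machine) and a constant $c$ such that on every instance $(G,k,E^*)$, with $G$ and $E^*$ given by their adjacency matrices, the algorithm halts with a correct output after at most $2^{\beta k\log_2 k}\cdot c\,(n+1)^c$ steps, where $k\log_2 k$ is read as $0$ for $k=0$. The value of $\beta$ is not part of the input. -/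

import Mathlib

/-! ## Link Respected Clique Cover -/

/-- `Cs` solves the instance `(G, k, Estar)`: a set of at most `k` cliques of `G` such that every
vertex lies in one of them and both ends of every edge of `Estar` lie in a common one. -/
structure IsLRCCSolution {V : Type*} (G : SimpleGraph V) (k : ℕ) (Estar : Set (Sym2 V))
    (Cs : Finset (Finset V)) : Prop where
  isClique : ∀ C ∈ Cs, G.IsClique (C : Set V)
  card_le : Cs.card ≤ k
  covers_vertices : ∀ v : V, ∃ C ∈ Cs, v ∈ C
  covers_edges : ∀ x y : V, s(x, y) ∈ Estar → ∃ C ∈ Cs, x ∈ C ∧ y ∈ C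

/-! ## Random access machines with a step count

The only arithmetic is adding or subtracting one. Hence no value in a run of `t` steps exceeds the
largest input value or program constant by more than `t`, and charging one step for every
instruction and every test is a realistic measure of time. -/

namespace RAM

/-- Memory of the machine: registers, and arrays with unbounded index. A program mentions only
finitely many registers and arrays, as their names are constants of the program; the index into an
array is the content of a register. -/
@[ext]
structure State where
  reg : ℕ → ℕ
  arr : ℕ → ℕ → ℕ

/-- The state with the content of register `x` replaced by `v`. -/
def State.setReg (s : State) (x v : ℕ) : State :=
  { s with reg := Function.update s.reg x v }

/-- The state with the entry `i` of array `a` replaced by `v`. -/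
def State.setArr (s : State) (a i v : ℕ) : State :=
  { s with arr := Function.update s.arr a (Function.update (s.arr a) i v) }

/-- Programs. -/
inductive Prog where
  /-- `R x := c` -/
  | const (x c : ℕ)
  /-- `R x := R y` -/
  | copy (x y : ℕ)
  /-- `R x := R x + 1` -/
  | inc (x : ℕ)
  /-- `R x := R x - 1`, and `0` if `R x = 0` -/
  | dec (x : ℕ)
  /-- `R x := A a [R i]` -/
  | load (x a i : ℕ)
  /-- `A a [R i] := R y` -/
  | store (a i y : ℕ)
  /-- `p ; q` -/
  | seq (p q : Prog)
  /-- `if R x < R y then p else q` -/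
  | branch (x y : ℕ) (p q : Prog)
  /-- `while R x < R y do p` -/
  | loop (x y : ℕ) (p : Prog)

/-- `Exec p s s₁ t`: started in `s`, the program `p` halts in `s₁` after exactly `t` steps. -/
inductive Exec : Prog → State → State → ℕ → Prop where
  | const (x c : ℕ) (s : State) : Exec (.const x c) s (s.setReg x c) 1
  | copy (x y : ℕ) (s : State) : Exec (.copy x y) s (s.setReg x (s.reg y)) 1
  | inc (x : ℕ) (s : State) : Exec (.inc x) s (s.setReg x (s.reg x + 1)) 1
  | dec (x : ℕ) (s : State) : Exec (.dec x) s (s.setReg x (s.reg x - 1)) 1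
  | load (x a i : ℕ) (s : State) : Exec (.load x a i) s (s.setReg x (s.arr a (s.reg i))) 1
  | store (a i y : ℕ) (s : State) : Exec (.store a i y) s (s.setArr a (s.reg i) (s.reg y)) 1
  | seq {p q : Prog} {s s₁ s₂ : State} {t₁ t₂ : ℕ} :
      Exec p s s₁ t₁ → Exec q s₁ s₂ t₂ → Exec (.seq p q) s s₂ (t₁ + t₂)
  | branch_true {x y : ℕ} {p q : Prog} {s s₁ : State} {t : ℕ} :
      s.reg x < s.reg y → Exec p s s₁ t → Exec (.branch x y p q) s s₁ (t + 1)
  | branch_false {x y : ℕ} {p q : Prog} {s s₁ : State} {t : ℕ} :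
      ¬ s.reg x < s.reg y → Exec q s s₁ t → Exec (.branch x y p q) s s₁ (t + 1)
  | loop_true {x y : ℕ} {p : Prog} {s s₁ s₂ : State} {t₁ t₂ : ℕ} :
      s.reg x < s.reg y → Exec p s s₁ t₁ → Exec (.loop x y p) s₁ s₂ t₂ →
        Exec (.loop x y p) s s₂ (t₁ + t₂ + 1)
  | loop_false {x y : ℕ} {p : Prog} {s : State} :
      ¬ s.reg x < s.reg y → Exec (.loop x y p) s s 1

/-- The machine is deterministic: the final state and the number of steps are determined by the
program and the initial state. -/
theorem Exec.deterministic {p : Prog} {s s₁ s₂ : State} {t₁ t₂ : ℕ}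
    (h₁ : Exec p s s₁ t₁) (h₂ : Exec p s s₂ t₂) : s₁ = s₂ ∧ t₁ = t₂ := by
  induction h₁ generalizing s₂ t₂ with
  | const | copy | inc | dec | load | store => cases h₂; exact ⟨rfl, rfl⟩
  | seq _ _ ih₁ ih₂ =>
    cases h₂ with
    | seq a b =>
      obtain ⟨rfl, rfl⟩ := ih₁ a
      obtain ⟨rfl, rfl⟩ := ih₂ b
      exact ⟨rfl, rfl⟩
  | branch_true h _ ih =>
    cases h₂ with
    | branch_true _ a => obtain ⟨rfl, rfl⟩ := ih a; exact ⟨rfl, rfl⟩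
    | branch_false h' _ => exact absurd h h'
  | branch_false h _ ih =>
    cases h₂ with
    | branch_true h' _ => exact absurd h' h
    | branch_false _ a => obtain ⟨rfl, rfl⟩ := ih a; exact ⟨rfl, rfl⟩
  | loop_true h _ _ ih₁ ih₂ =>
    cases h₂ with
    | loop_true _ a b =>
      obtain ⟨rfl, rfl⟩ := ih₁ a
      obtain ⟨rfl, rfl⟩ := ih₂ b
      exact ⟨rfl, rfl⟩
    | loop_false h' => exact absurd h h'
  | loop_false h =>
    cases h₂ with
    | loop_true h' _ _ => exact absurd h' h
    | loop_false _ => exact ⟨rfl, rfl⟩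

end RAM

/-! ## Instances and answers in memory -/

open Classical in
/-- The memory that holds the instance `(G, k, Estar)` with vertices `0, …, n - 1`: register `0`
holds `n`, register `1` holds `k`, array `0` is the adjacency matrix of `G` and array `1` that of
`Estar`, both stored row by row (the entry of `(u, v)` at the index `u * n + v`). All other
registers and entries are `0`. -/
noncomputable def lrccInput {n : ℕ} (G : SimpleGraph (Fin n)) (k : ℕ)
    (Estar : Set (Sym2 (Fin n))) : RAM.State where
  reg x := if x = 0 then n else if x = 1 then k else 0
  arr a i :=
    if a = 0 then (if ∃ u v : Fin n, i = u * n + v ∧ G.Adj u v then 1 else 0)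
    else if a = 1 then (if ∃ u v : Fin n, i = u * n + v ∧ s(u, v) ∈ Estar then 1 else 0)
    else 0

/-- The answer that a memory holds. It is `NO`, written `none`, if register `0` is `0`. Otherwise it
is a set of vertex sets: register `1` holds the number `r` of the sets in the list (repetitions
count once), and array `2` holds the `r × n` incidence matrix, row by row. -/
def lrccOutput (n : ℕ) (s : RAM.State) : Option (Finset (Finset (Fin n))) :=
  if s.reg 0 = 0 then none
  else some ((Finset.range (s.reg 1)).image
    (fun l => Finset.univ.filter (fun v : Fin n => s.arr 2 (l * n + v) ≠ 0)))

/-- `ans` is a correct answer for the instance `(G, k, Estar)`: a solution, or `NO` if there is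
none. -/
def IsLRCCAnswer {V : Type*} (G : SimpleGraph V) (k : ℕ) (Estar : Set (Sym2 V)) :
    Option (Finset (Finset V)) → Prop
  | some Cs => IsLRCCSolution G k Estar Cs
  | none => ¬ ∃ Cs : Finset (Finset V), IsLRCCSolution G k Estar Cs

/-! The algorithm is a bounded search tree. Covering a vertex `v` is treated as covering the pair
`(v, v)`, so every requirement is a pair that must lie in a common clique. A node of the tree is a
family of `K` cliques, initially all empty. If a required pair is uncovered, any solution extending
the family puts both ends into one of its `K` sets. It therefore suffices to branch on the index of
that set and to keep the children in which the enlarged set is still a clique. Each branching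
increases the sum of the set sizes, and this sum is at most `β * K` because all sets are cliques. So
the tree has at most `β * K + 1` levels with at most `k ^ (β * k) = 2 ^ (β k log k)` nodes each.

The families wait in a queue, so no recursion is needed and `β` enters the analysis alone, not the
program. `K = min k (n * n)` keeps the work per node polynomial in `n` for huge `k`. Nothing is
lost, since one clique for each of the `n * n` ordered pairs is enough
(`exists_family_of_solution`).

Two invariants carry the proof (`searching_expansion`). Every solution contains, set by set, some
queued family, so an empty queue justifies the answer NO. The sizes of the subtrees below the queued
families sum to at most a budget that drops by one in each iteration. Polynomial subroutines are
verified by `wp`, whose loops make at most `B` iterations; the exponential main loop is handled by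
`exec_loop`. -/

namespace RAM

/-! ### Registers and arrays after an assignment. -/

@[simp] theorem State.setReg_reg (s : State) (x v y : ℕ) :
    (s.setReg x v).reg y = if y = x then v else s.reg y := by
  simp [State.setReg, Function.update_apply]

@[simp] theorem State.setReg_arr (s : State) (x v : ℕ) : (s.setReg x v).arr = s.arr := rfl

@[simp] theorem State.setArr_reg (s : State) (a i v : ℕ) : (s.setArr a i v).reg = s.reg := rfl

@[simp] theorem State.setArr_arr (s : State) (a i v b j : ℕ) :
    (s.setArr a i v).arr b j = if b = a ∧ j = i then v else s.arr b j := by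
  by_cases h : b = a
  · subst h; simp [State.setArr, Function.update_apply]
  · simp [State.setArr, h]

/-! ### Predicate transformer, cost and frame -/

/-- Weakest precondition of `p` for the postcondition `Q`, when every loop makes at most `B`
iterations. -/
def wp (B : ℕ) : Prog → (State → Prop) → State → Prop
  | .const x c, Q => fun s => Q (s.setReg x c)
  | .copy x y, Q => fun s => Q (s.setReg x (s.reg y))
  | .inc x, Q => fun s => Q (s.setReg x (s.reg x + 1))
  | .dec x, Q => fun s => Q (s.setReg x (s.reg x - 1))
  | .load x a i, Q => fun s => Q (s.setReg x (s.arr a (s.reg i)))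
  | .store a i y, Q => fun s => Q (s.setArr a (s.reg i) (s.reg y))
  | .seq p q, Q => wp B p (wp B q Q)
  | .branch x y p q, Q => fun s =>
      (s.reg x < s.reg y → wp B p Q s) ∧ (¬ s.reg x < s.reg y → wp B q Q s)
  -- The recursion unrolls exactly `m` iterations: the test succeeds `m` times and then fails.
  -- Termination is thus part of the condition.
  | .loop x y p, Q => fun s => ∃ m ≤ B,
      Nat.rec (motive := fun _ => State → Prop) (fun s => ¬ s.reg x < s.reg y ∧ Q s)
        (fun _ J s => s.reg x < s.reg y ∧ wp B p J s) m s

/-- Bound on the number of steps of a program whose loops make at most `B` iterations each. -/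
def Prog.cost (B : ℕ) : Prog → ℕ
  | .seq p q => p.cost B + q.cost B
  | .branch _ _ p q => p.cost B + q.cost B + 1
  | .loop _ _ p => B * (p.cost B + 1) + 1
  | _ => 1

theorem wp_sound {B : ℕ} {p : Prog} {Q : State → Prop} {s : State} (h : wp B p Q s) :
    ∃ s' t, Exec p s s' t ∧ t ≤ p.cost B ∧ Q s' := by
  induction p generalizing Q s with
  | const x c => exact ⟨_, _, .const .., le_rfl, h⟩
  | copy x y => exact ⟨_, _, .copy .., le_rfl, h⟩
  | inc x => exact ⟨_, _, .inc .., le_rfl, h⟩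
  | dec x => exact ⟨_, _, .dec .., le_rfl, h⟩
  | load x a i => exact ⟨_, _, .load .., le_rfl, h⟩
  | store a i y => exact ⟨_, _, .store .., le_rfl, h⟩
  | seq p q ihp ihq =>
    obtain ⟨s₁, t₁, e₁, l₁, h₁⟩ := ihp h
    obtain ⟨s₂, t₂, e₂, l₂, h₂⟩ := ihq h₁
    exact ⟨s₂, _, .seq e₁ e₂, by simp only [Prog.cost]; omega, h₂⟩
  | branch x y p q ihp ihq =>
    by_cases hc : s.reg x < s.reg y
    · obtain ⟨s₁, t₁, e₁, l₁, h₁⟩ := ihp (h.1 hc)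
      exact ⟨s₁, _, .branch_true hc e₁, by simp only [Prog.cost]; omega, h₁⟩
    · obtain ⟨s₁, t₁, e₁, l₁, h₁⟩ := ihq (h.2 hc)
      exact ⟨s₁, _, .branch_false hc e₁, by simp only [Prog.cost]; omega, h₁⟩
  | loop x y p ih =>
    obtain ⟨m, hm, h⟩ := h
    -- The induction needs the bound in terms of the actual number `m` of iterations; `m ≤ B` is
    -- used only afterwards.
    suffices H : ∃ s' t, Exec (.loop x y p) s s' t ∧ t ≤ m * (p.cost B + 1) + 1 ∧ Q s' by
      obtain ⟨s', t, e, l, h⟩ := H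
      exact ⟨s', t, e, l.trans (by simp only [Prog.cost]; gcongr), h⟩
    clear hm
    induction m generalizing s with
    | zero => exact ⟨s, 1, .loop_false h.1, by simp, h.2⟩
    | succ m ihm =>
      obtain ⟨s₁, t₁, e₁, l₁, h₁⟩ := ih h.2
      obtain ⟨s₂, t₂, e₂, l₂, h₂⟩ := ihm h₁
      exact ⟨s₂, _, .loop_true h.1 e₁ e₂, by rw [add_mul]; omega, h₂⟩

theorem wp_mono {B : ℕ} {p : Prog} {Q Q' : State → Prop} {s : State} (h : wp B p Q s)
    (hQ : ∀ s', Q s' → Q' s') : wp B p Q' s := by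
  induction p generalizing Q Q' s with
  | const | copy | inc | dec | load | store => exact hQ _ h
  | seq p q ihp ihq => exact ihp h fun s' h' => ihq h' hQ
  | branch x y p q ihp ihq => exact ⟨fun hc => ihp (h.1 hc) hQ, fun hc => ihq (h.2 hc) hQ⟩
  | loop x y p ih =>
    obtain ⟨m, hm, h⟩ := h
    refine ⟨m, hm, ?_⟩
    clear hm
    induction m generalizing s with
    | zero => exact ⟨h.1, hQ _ h.2⟩
    | succ m ihm => exact ⟨h.1, ih h.2 fun s' h' => ihm h'⟩

/-- Whether a program contains an assignment to register `r`. -/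
def Prog.writesReg (r : ℕ) : Prog → Bool
  | .const x _ | .copy x _ | .inc x | .dec x | .load x _ _ => r == x
  | .store _ _ _ => false
  | .seq p q | .branch _ _ p q => p.writesReg r || q.writesReg r
  | .loop _ _ p => p.writesReg r

/-- Whether a program contains an assignment to an entry of array `a`. -/
def Prog.writesArr (a : ℕ) : Prog → Bool
  | .store b _ _ => a == b
  | .seq p q | .branch _ _ p q => p.writesArr a || q.writesArr a
  | .loop _ _ p => p.writesArr a
  | _ => false

/-- `s'` agrees with `s` wherever `p` does not write. -/
structure Frame (p : Prog) (s s' : State) : Prop where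
  reg : ∀ r, p.writesReg r = false → s'.reg r = s.reg r
  arr : ∀ a, p.writesArr a = false → s'.arr a = s.arr a

theorem Frame.refl (p : Prog) (s : State) : Frame p s s := ⟨fun _ _ => rfl, fun _ _ => rfl⟩

theorem Frame.trans {p : Prog} {s s' s'' : State} (h : Frame p s s') (h' : Frame p s' s'') :
    Frame p s s'' :=
  ⟨fun r hr => (h'.reg r hr).trans (h.reg r hr), fun a ha => (h'.arr a ha).trans (h.arr a ha)⟩

theorem Frame.of_imp {p q : Prog} {s s' : State} (h : Frame p s s')
    (hr : ∀ r, q.writesReg r = false → p.writesReg r = false)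
    (ha : ∀ r, q.writesArr r = false → p.writesArr r = false) : Frame q s s' :=
  ⟨fun r h' => h.reg r (hr r h'), fun a h' => h.arr a (ha a h')⟩

theorem Exec.frame {p : Prog} {s s' : State} {t : ℕ} (h : Exec p s s' t) : Frame p s s' := by
  induction h with
  | const | copy | inc | dec | load =>
    exact ⟨fun r hr => by simp_all [Prog.writesReg], fun _ _ => rfl⟩
  | store a i y s =>
    refine ⟨fun _ _ => rfl, fun b hb => ?_⟩
    funext j
    simp_all [Prog.writesArr]
  | seq _ _ ih₁ ih₂ =>
    exact (ih₁.of_imp (by simp +contextual [Prog.writesReg])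
      (by simp +contextual [Prog.writesArr])).trans
      (ih₂.of_imp (by simp +contextual [Prog.writesReg]) (by simp +contextual [Prog.writesArr]))
  | branch_true _ _ ih | branch_false _ _ ih =>
    exact ih.of_imp (by simp +contextual [Prog.writesReg]) (by simp +contextual [Prog.writesArr])
  | loop_true _ _ _ ih₁ ih₂ =>
    exact (ih₁.of_imp (by simp +contextual [Prog.writesReg])
      (by simp +contextual [Prog.writesArr])).trans ih₂
  | loop_false => exact Frame.refl _ _

/-- This lets specifications stay silent about untouched memory: what a concrete program leaves
alone is found by evaluating `writesReg` and `writesArr`. -/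
theorem wp_frame {B : ℕ} {p : Prog} {Q : State → Prop} {s : State} (h : wp B p Q s) :
    wp B p (fun s' => Q s' ∧ Frame p s s') s := by
  induction p generalizing Q s with
  | const => exact ⟨h, (Exec.const ..).frame⟩
  | copy => exact ⟨h, (Exec.copy ..).frame⟩
  | inc => exact ⟨h, (Exec.inc ..).frame⟩
  | dec => exact ⟨h, (Exec.dec ..).frame⟩
  | load => exact ⟨h, (Exec.load ..).frame⟩
  | store => exact ⟨h, (Exec.store ..).frame⟩
  | seq p q ihp ihq =>
    change wp B p (wp B q _) s
    refine wp_mono (ihp h) fun s₁ h₁ => wp_mono (ihq h₁.1) fun s₂ h₂ => ⟨h₂.1, ?_⟩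
    exact (h₁.2.of_imp (by simp +contextual [Prog.writesReg])
      (by simp +contextual [Prog.writesArr])).trans
      (h₂.2.of_imp (by simp +contextual [Prog.writesReg]) (by simp +contextual [Prog.writesArr]))
  | branch x y p q ihp ihq =>
    exact ⟨fun hc => wp_mono (ihp (h.1 hc)) fun s₁ h₁ => ⟨h₁.1, h₁.2.of_imp
      (by simp +contextual [Prog.writesReg]) (by simp +contextual [Prog.writesArr])⟩,
      fun hc => wp_mono (ihq (h.2 hc)) fun s₁ h₁ => ⟨h₁.1, h₁.2.of_imp
      (by simp +contextual [Prog.writesReg]) (by simp +contextual [Prog.writesArr])⟩⟩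
  | loop x y p ih =>
    obtain ⟨m, hm, h⟩ := h
    refine ⟨m, hm, ?_⟩
    clear hm
    -- The frame is always relative to the initial state `s`, so it is accumulated while the current
    -- state `s₁` varies.
    have H : ∀ s₁, Frame (.loop x y p) s s₁ →
        Nat.rec (motive := fun _ => State → Prop) (fun s => ¬ s.reg x < s.reg y ∧ Q s)
          (fun _ J s => s.reg x < s.reg y ∧ wp B p J s) m s₁ →
        Nat.rec (motive := fun _ => State → Prop)
          (fun s₂ => ¬ s₂.reg x < s₂.reg y ∧ Q s₂ ∧ Frame (.loop x y p) s s₂)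
          (fun _ J s => s.reg x < s.reg y ∧ wp B p J s) m s₁ := by
      clear h
      induction m with
      | zero => exact fun s₁ hf h => ⟨h.1, h.2, hf⟩
      | succ m ihm =>
        exact fun s₁ hf h => ⟨h.1, wp_mono (ih h.2) fun s₂ h₂ =>
          ihm s₂ (hf.trans (h₂.2.of_imp (fun _ h => h) (fun _ h => h))) h₂.1⟩
    exact H s (Frame.refl _ _) h

theorem wp_of_frame {B : ℕ} {p : Prog} {Q Q' : State → Prop} {s : State} (h : wp B p Q s)
    (hQ : ∀ s', Frame p s s' → Q s' → Q' s') : wp B p Q' s :=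
  wp_mono (wp_frame h) fun s' h' => hQ s' h'.2 h'.1

theorem wp_seq_of_frame {B : ℕ} {p q : Prog} {Q Q' : State → Prop} {s : State} (h : wp B p Q s)
    (hQ : ∀ s', Frame p s s' → Q s' → wp B q Q' s') : wp B (.seq p q) Q' s :=
  wp_of_frame (p := p) h hQ

/-! ### Counting loops -/

/-- `for R i := 0, …, R N - 1 do p` -/
def forTo (i N : ℕ) (p : Prog) : Prog :=
  .seq (.const i 0) (.loop i N (.seq p (.inc i)))

/-- The body changes neither counter nor bound, so there are exactly `s.reg N` iterations. The step
condition already accounts for the final `inc i`, hence the `setReg` in its postcondition. -/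
theorem wp_forTo {B i N : ℕ} {p : Prog} {Q : State → Prop} {s : State}
    (I : ℕ → State → Prop) (hB : s.reg N ≤ B) (hi : p.writesReg i = false)
    (hN : p.writesReg N = false) (hiN : i ≠ N)
    (h0 : I 0 (s.setReg i 0))
    (hstep : ∀ j < s.reg N, ∀ s', s'.reg i = j → Frame (forTo i N p) s s' → I j s' →
      wp B p (fun s'' => s''.reg i = j → Frame (forTo i N p) s s'' →
        I (j + 1) (s''.setReg i (j + 1))) s')
    (hQ : ∀ s', s'.reg i = s.reg N → Frame (forTo i N p) s s' → I (s.reg N) s' → Q s') :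
    wp B (forTo i N p) Q s := by
  have key : ∀ m j s', j + m = s.reg N → s'.reg i = j → Frame (forTo i N p) s s' → I j s' →
      Nat.rec (motive := fun _ => State → Prop) (fun s => ¬ s.reg i < s.reg N ∧ Q s)
        (fun _ J s => s.reg i < s.reg N ∧ wp B (.seq p (.inc i)) J s) m s' := by
    have hfN : ∀ s', Frame (forTo i N p) s s' → s'.reg N = s.reg N := fun s' hf =>
      hf.reg N (by simp [forTo, Prog.writesReg, hN, hiN.symm])
    intro m
    induction m with
    | zero =>
      intro j s' hj hij hf hI
      have hj' : j = s.reg N := by omega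
      subst hj'
      exact ⟨by rw [hij, hfN s' hf]; exact lt_irrefl _, hQ s' hij hf hI⟩
    | succ m ih =>
      intro j s' hj hij hf hI
      refine ⟨by rw [hij, hfN s' hf]; omega, ?_⟩
      change wp B p (wp B (.inc i) _) s'
      refine wp_of_frame (hstep j (by omega) s' hij hf hI) fun s₁ hf₁ h₁ => ?_
      have hij₁ : s₁.reg i = j := (hf₁.reg i hi).trans hij
      have hF : Frame (forTo i N p) s s₁ := hf.trans (hf₁.of_imp
        (by simp +contextual [forTo, Prog.writesReg])
        (by simp +contextual [forTo, Prog.writesArr]))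
      have := h₁ hij₁ hF
      refine ih (j + 1) _ (by omega) (by simp [hij₁]) (hF.trans ?_) (by rw [hij₁]; exact this)
      exact (Exec.inc i s₁).frame.of_imp (by simp +contextual [forTo, Prog.writesReg])
        (by simp +contextual [forTo, Prog.writesArr])
  refine ⟨s.reg N, by simpa [hiN.symm] using hB, key _ 0 _ (by simp) (by simp) ?_ h0⟩
  exact (Exec.const i 0 s).frame.of_imp (by simp +contextual [forTo, Prog.writesReg])
        (by simp +contextual [forTo, Prog.writesArr])

/-! ### Long loops with a budget, and polynomial cost. -/

/-- `while` loops whose number of iterations is bounded by a budget `m`. -/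
theorem exec_loop {B x y : ℕ} {p : Prog} (I : ℕ → State → Prop)
    (hstep : ∀ m s, I m s → s.reg x < s.reg y → ∃ m', m = m' + 1 ∧ wp B p (I m') s)
    (m : ℕ) (s : State) (h : I m s) :
    ∃ s' t, Exec (.loop x y p) s s' t ∧ t ≤ m * (p.cost B + 1) + 1 ∧ ¬ s'.reg x < s'.reg y ∧
      ∃ m', I m' s' := by
  induction m generalizing s with
  | zero =>
    by_cases hc : s.reg x < s.reg y
    · obtain ⟨m', h', _⟩ := hstep _ _ h hc
      omega
    · exact ⟨s, 1, .loop_false hc, by simp, hc, _, h⟩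
  | succ m ih =>
    by_cases hc : s.reg x < s.reg y
    · obtain ⟨m', h', hw⟩ := hstep _ _ h hc
      obtain rfl : m = m' := by omega
      obtain ⟨s₁, t₁, e₁, l₁, h₁⟩ := wp_sound hw
      obtain ⟨s₂, t₂, e₂, l₂, h₂⟩ := ih s₁ h₁
      exact ⟨s₂, _, .loop_true hc e₁ e₂, by rw [add_mul]; omega, h₂⟩
    · exact ⟨s, 1, .loop_false hc, by simp, hc, _, h⟩

/-- Each level of loop nesting contributes one factor `B`. Using one constant as both factor and
exponent makes such bounds closed under sums when `1 ≤ B`. -/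
theorem Prog.exists_cost_le (p : Prog) : ∃ c, ∀ B, 1 ≤ B → p.cost B ≤ c * B ^ c := by
  have add : ∀ {f g : ℕ → ℕ}, (∃ c, ∀ B, 1 ≤ B → f B ≤ c * B ^ c) →
      (∃ c, ∀ B, 1 ≤ B → g B ≤ c * B ^ c) → ∃ c, ∀ B, 1 ≤ B → f B + g B ≤ c * B ^ c := by
    rintro f g ⟨c, hc⟩ ⟨d, hd⟩
    refine ⟨c + d, fun B hB => ?_⟩
    calc f B + g B ≤ c * B ^ c + d * B ^ d := add_le_add (hc B hB) (hd B hB)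
      _ ≤ c * B ^ (c + d) + d * B ^ (c + d) := by gcongr <;> omega
      _ = _ := by ring
  have one : ∃ c, ∀ B : ℕ, 1 ≤ B → 1 ≤ c * B ^ c := ⟨1, fun B hB => by simpa using hB⟩
  induction p with
  | const | copy | inc | dec | load | store => exact one
  | seq p q ihp ihq => exact add ihp ihq
  | branch x y p q ihp ihq => exact add (add ihp ihq) one
  | loop x y p ih =>
    obtain ⟨c, hc⟩ := add ih one
    refine add ⟨c + 1, fun B hB => ?_⟩ one
    calc B * (p.cost B + 1) ≤ B * (c * B ^ c) := by gcongr; exact hc B hB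
      _ = c * B ^ (c + 1) := by ring
      _ ≤ _ := by gcongr; omega

/-! ### Arithmetic -/

/-- `R d := R d + R y`, with register `20` as a counter -/
def addTo (d y : ℕ) : Prog := forTo 20 y (.inc d)

theorem wp_addTo {B d y : ℕ} {Q : State → Prop} {s : State} (hB : s.reg y ≤ B)
    (h1 : d ≠ 20 := by decide) (h2 : d ≠ y := by decide) (h3 : 20 ≠ y := by decide)
    (hQ : Q ((s.setReg d (s.reg d + s.reg y)).setReg 20 (s.reg y))) :
    wp B (addTo d y) Q s := by
  refine wp_forTo (fun j s' => s'.reg d = s.reg d + j ∧ s'.arr = s.arr ∧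
      ∀ r, r ≠ d → r ≠ 20 → s'.reg r = s.reg r) hB
    (by simp [Prog.writesReg, h1.symm]) (by simp [Prog.writesReg, h2.symm]) h3 ?_ ?_ ?_
  · simp +contextual [h1]
  · rintro j hj s' hi hf ⟨hd, ha, hr⟩
    simp only [wp]
    intro _ _
    refine ⟨by simp [h1, hd, add_assoc], by simpa using ha, fun r h h' => ?_⟩
    simp [h, h', hr]
  · rintro s' hi hf ⟨hd, ha, hr⟩
    convert hQ using 1
    ext r
    · by_cases h : r = 20
      · subst h; simp [hi]
      by_cases h' : r = d
      · subst h'; simp [h, hd]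
      simp [h, h', hr]
    · simp [ha]

/-- `R d := R d + R x * R 0`, with registers `20` and `21` as counters -/
def addMul (d x : ℕ) : Prog := forTo 21 x (addTo d 0)

theorem wp_addMul {B d x : ℕ} {Q : State → Prop} {s : State} (hB : s.reg x ≤ B)
    (hB0 : s.reg 0 ≤ B)
    (h1 : d ≠ 20 := by decide) (h2 : d ≠ 21 := by decide) (h3 : d ≠ 0 := by decide)
    (h4 : d ≠ x := by decide) (h5 : x ≠ 20 := by decide) (h6 : x ≠ 21 := by decide)
    (hQ : ∀ s', s'.reg d = s.reg d + s.reg x * s.reg 0 → s'.arr = s.arr →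
      (∀ r, r ≠ d → r ≠ 20 → r ≠ 21 → s'.reg r = s.reg r) → Q s') :
    wp B (addMul d x) Q s := by
  refine wp_forTo (fun j s' => s'.reg d = s.reg d + j * s.reg 0 ∧ s'.arr = s.arr ∧
      ∀ r, r ≠ d → r ≠ 20 → r ≠ 21 → s'.reg r = s.reg r) hB
    (by simp [Prog.writesReg, addTo, forTo, h2.symm])
    (by simp [Prog.writesReg, addTo, forTo, h4.symm, h5]) h6.symm ?_ ?_ ?_
  · simp +contextual [h2]
  · rintro j hj s' hi hf ⟨hd, ha, hr⟩
    have h0 := hr 0 h3.symm (by decide) (by decide)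
    refine wp_addTo (by rw [h0]; exact hB0) h1 h3 (by decide) fun _ _ => ?_
    refine ⟨by simp [h1, h2, hd, h0]; ring, by simpa using ha, fun r h h' h'' => ?_⟩
    simp [h, h', h'', hr]
  · rintro s' hi hf ⟨hd, ha, hr⟩
    exact hQ s' hd ha hr

/-- `R d := R b + R x * R 0 + R y`, with registers `20` and `21` as counters -/
def address (d b x y : ℕ) : Prog :=
  .seq (.copy d b) (.seq (addMul d x) (addTo d y))

theorem wp_address {B d b x y : ℕ} {Q : State → Prop} {s : State} (hx : s.reg x ≤ B)
    (hy : s.reg y ≤ B) (hB0 : s.reg 0 ≤ B)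
    (hQ : ∀ s', s'.reg d = s.reg b + s.reg x * s.reg 0 + s.reg y → s'.arr = s.arr →
      (∀ r, r ≠ d → r ≠ 20 → r ≠ 21 → s'.reg r = s.reg r) → Q s')
    (h1 : d ≠ 20 := by decide) (h2 : d ≠ 21 := by decide) (h3 : d ≠ 0 := by decide)
    (h4 : d ≠ x := by decide) (h5 : x ≠ 20 := by decide) (h6 : x ≠ 21 := by decide)
    (h7 : d ≠ y := by decide) (h8 : y ≠ 20 := by decide) (h9 : y ≠ 21 := by decide) :
    wp B (address d b x y) Q s := by
  refine wp_addMul (by simpa [h4.symm] using hx) (by simpa [h3.symm] using hB0) h1 h2 h3 h4 h5 h6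
    fun s₁ hd ha hr => ?_
  have hy' : s₁.reg y = s.reg y := by rw [hr y h7.symm h8 h9]; simp [h7.symm]
  refine wp_addTo (by rw [hy']; exact hy) h1 h7 h8.symm (hQ _ ?_ ?_ ?_)
  · simp [h1, hd, hy', h3.symm, h4.symm]
  · simp [ha]
  · intro r h h' h''
    simp [h, h', hr r h h' h'']

/-! ### Building blocks of the search -/

/-- The program that does nothing, apart from using register `25`. -/
def skip : Prog := .copy 25 25

/-- `R d := A a [R b + R x * R 0 + R y]` -/
def fetch (d a b x y : ℕ) : Prog := .seq (address 22 b x y) (.load d a 22)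

theorem wp_fetch {B d a b x y : ℕ} {Q : State → Prop} {s : State} (hx : s.reg x ≤ B)
    (hy : s.reg y ≤ B) (hB0 : s.reg 0 ≤ B)
    (hQ : ∀ s', s'.reg d = s.arr a (s.reg b + s.reg x * s.reg 0 + s.reg y) → s'.arr = s.arr →
      (∀ r, r ≠ d → r ≠ 20 → r ≠ 21 → r ≠ 22 → s'.reg r = s.reg r) → Q s')
    (h4 : 22 ≠ x := by decide) (h5 : x ≠ 20 := by decide) (h6 : x ≠ 21 := by decide)
    (h7 : 22 ≠ y := by decide) (h8 : y ≠ 20 := by decide) (h9 : y ≠ 21 := by decide) :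
    wp B (fetch d a b x y) Q s := by
  refine wp_address hx hy hB0 (fun s₁ hd ha hr => ?_) (h4 := h4) (h5 := h5) (h6 := h6)
    (h7 := h7) (h8 := h8) (h9 := h9)
  refine hQ _ (by simp [ha, hd]) (by simp [ha]) fun r h h' h'' h3 => ?_
  simp [h, hr r h3 h' h'']

/-- `A a [R b + R x * R 0 + R y] := R v` -/
def put (a b x y v : ℕ) : Prog := .seq (address 22 b x y) (.store a 22 v)

theorem wp_put {B a b x y v : ℕ} {Q : State → Prop} {s : State} (hx : s.reg x ≤ B)
    (hy : s.reg y ≤ B) (hB0 : s.reg 0 ≤ B)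
    (hQ : ∀ s', (∀ c i, s'.arr c i =
        if c = a ∧ i = s.reg b + s.reg x * s.reg 0 + s.reg y then s.reg v else s.arr c i) →
      (∀ r, r ≠ 20 → r ≠ 21 → r ≠ 22 → s'.reg r = s.reg r) → Q s')
    (h4 : 22 ≠ x := by decide) (h5 : x ≠ 20 := by decide) (h6 : x ≠ 21 := by decide)
    (h7 : 22 ≠ y := by decide) (h8 : y ≠ 20 := by decide) (h9 : y ≠ 21 := by decide)
    (h10 : v ≠ 20 := by decide) (h11 : v ≠ 21 := by decide) (h12 : v ≠ 22 := by decide) :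
    wp B (put a b x y v) Q s := by
  refine wp_address hx hy hB0 (fun s₁ hd ha hr => ?_) (h4 := h4) (h5 := h5) (h6 := h6)
    (h7 := h7) (h8 := h8) (h9 := h9)
  refine hQ _ (fun c i => ?_) fun r h h' h3 => ?_
  · simp [ha, hd, hr v h12 h10 h11]
  · simp [hr r h3 h h']

/-! ### Testing and copying a single incidence matrix. -/

/-- Some row `l < K` of the incidence matrix at `b` in `A` contains both `x` and `y`. -/
def Covers (A : ℕ → ℕ) (n K b x y : ℕ) : Prop :=
  ∃ l < K, 0 < A (b + l * n + x) ∧ 0 < A (b + l * n + y)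

/-- Row `l` of the incidence matrix at `b` in `A` is a clique for the reflexive relation `D`. -/
def RowClique (A D : ℕ → ℕ) (n b l : ℕ) : Prop :=
  ∀ x < n, ∀ y < n, 0 < A (b + l * n + x) → 0 < A (b + l * n + y) → 0 < D (x * n + y)

/-- The registers `0` and `3` hold the width and the height of the incidence matrices, `2` and `4`
hold `0` and `1`, and `23` holds the size of the incidence matrices. -/
structure Ready (B n K : ℕ) (s : State) : Prop where
  n_eq : s.reg 0 = n
  K_eq : s.reg 3 = K
  zero_eq : s.reg 2 = 0
  one_eq : s.reg 4 = 1
  size_eq : s.reg 23 = K * n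
  n_le : n ≤ B
  K_le : K ≤ B
  size_le : K * n ≤ B

/-- No subprogram of the search writes the five reserved registers, which `decide` checks for each
concrete program. -/
theorem Ready.of_frame {B n K : ℕ} {s s' : State} (h : Ready B n K s) {p : Prog}
    (hf : Frame p s s') (h0 : p.writesReg 0 = false := by decide)
    (h2 : p.writesReg 2 = false := by decide) (h3 : p.writesReg 3 = false := by decide)
    (h4 : p.writesReg 4 = false := by decide)
    (h23 : p.writesReg 23 = false := by decide) : Ready B n K s' :=
  ⟨(hf.reg 0 h0).trans h.n_eq, (hf.reg 3 h3).trans h.K_eq, (hf.reg 2 h2).trans h.zero_eq,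
    (hf.reg 4 h4).trans h.one_eq, (hf.reg 23 h23).trans h.size_eq, h.n_le, h.K_le, h.size_le⟩

/-- Sets register `17` to `1` if the matrix at `R 5` covers `R 13` and `R 14`, and to `0` if not. -/
def testCovered : Prog :=
  .seq (.const 17 0) <| forTo 15 3 <| .seq (fetch 18 3 5 15 13) <| .seq (fetch 19 3 5 15 14) <|
    .branch 2 18 (.branch 2 19 (.const 17 1) skip) skip

theorem wp_testCovered {B n K : ℕ} {s : State} (h : Ready B n K s) (hx : s.reg 13 < n)
    (hy : s.reg 14 < n) :
    wp B testCovered (fun s' =>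
      0 < s'.reg 17 ↔ Covers (s.arr 3) n K (s.reg 5) (s.reg 13) (s.reg 14)) s := by
  obtain ⟨h0, h3, h2, h4, h23, hn, hK, hS⟩ := h
  refine wp_forTo (fun j s' => 0 < s'.reg 17 ↔
    Covers (s.arr 3) n j (s.reg 5) (s.reg 13) (s.reg 14)) (by simp [h3, hK])
    (by decide) (by decide) (by decide) (by simp [Covers]) ?_ ?_
  · intro j hj s₁ hj₁ hf hI
    have e3 := hf.arr 3 rfl
    have r5 := hf.reg 5 rfl
    have r13 := hf.reg 13 rfl
    have r14 := hf.reg 14 rfl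
    have r0 := hf.reg 0 rfl
    have r2 := hf.reg 2 rfl
    simp [h3, h0, h2] at e3 r5 r13 r14 r0 r2 hj
    refine wp_fetch (by omega) (by omega) (by omega) fun s₂ ha₂ harr₂ hr₂ => ?_
    refine wp_fetch ?_ ?_ ?_ fun s₃ ha₃ harr₃ hr₃ => ?_
    · rw [hr₂ 15 (by decide) (by decide) (by decide) (by decide)]; omega
    · rw [hr₂ 14 (by decide) (by decide) (by decide) (by decide)]; omega
    · rw [hr₂ 0 (by decide) (by decide) (by decide) (by decide)]; omega
    have b18 : s₃.reg 18 = s.arr 3 (s.reg 5 + j * n + s.reg 13) := by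
      rw [hr₃ 18 (by decide) (by decide) (by decide) (by decide), ha₂, r5, hj₁, r0, r13, e3]
    have b19 : s₃.reg 19 = s.arr 3 (s.reg 5 + j * n + s.reg 14) := by
      rw [ha₃, harr₂, hr₂ 5 (by decide) (by decide) (by decide) (by decide),
        hr₂ 15 (by decide) (by decide) (by decide) (by decide),
        hr₂ 0 (by decide) (by decide) (by decide) (by decide),
        hr₂ 14 (by decide) (by decide) (by decide) (by decide), r5, hj₁, r0, r14, e3]
    have b2 : s₃.reg 2 = 0 := by
      rw [hr₃ 2 (by decide) (by decide) (by decide) (by decide),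
        hr₂ 2 (by decide) (by decide) (by decide) (by decide), r2]
    have b17 : s₃.reg 17 = s₁.reg 17 := by
      rw [hr₃ 17 (by decide) (by decide) (by decide) (by decide),
        hr₂ 17 (by decide) (by decide) (by decide) (by decide)]
    have hC : Covers (s.arr 3) n (j + 1) (s.reg 5) (s.reg 13) (s.reg 14) ↔
        Covers (s.arr 3) n j (s.reg 5) (s.reg 13) (s.reg 14) ∨
          (0 < s₃.reg 18 ∧ 0 < s₃.reg 19) := by
      rw [b18, b19]
      simp only [Covers, Nat.lt_succ_iff_lt_or_eq, or_and_right, exists_or, exists_eq_left]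
    simp only [hC, ← hI, ← b17, skip, wp, b2]
    refine ⟨fun h => ⟨fun h' => ?_, fun h' => ?_⟩, fun h => ?_⟩ <;> intro _ _ <;> simp_all
  · intro s' _ _ hI
    simpa [h3] using hI

/-- Looks for a pair of vertices marked in array `1` that the matrix at `R 5` does not cover.
Register `10` tells whether there is one, and registers `11` and `12` hold it. -/
def scan : Prog :=
  .seq (.const 10 0) <| forTo 13 0 <| forTo 14 0 <| .seq (fetch 16 1 2 13 14) <|
    .branch 2 16 (.seq testCovered <|
      .branch 2 17 skip <| .seq (.copy 11 13) <| .seq (.copy 12 14) (.const 10 1)) skip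

/-- The result of `scan` when it has looked at the pairs in `P`. -/
def ScanResult (s : State) (n K : ℕ) (P : ℕ → ℕ → Prop) (s' : State) : Prop :=
  (0 < s'.reg 10 → s'.reg 11 < n ∧ s'.reg 12 < n ∧ 0 < s.arr 1 (s'.reg 11 * n + s'.reg 12) ∧
    ¬ Covers (s.arr 3) n K (s.reg 5) (s'.reg 11) (s'.reg 12)) ∧
  (s'.reg 10 = 0 → ∀ x < n, ∀ y < n, P x y → 0 < s.arr 1 (x * n + y) →
    Covers (s.arr 3) n K (s.reg 5) x y)

theorem wp_scan {B n K : ℕ} {s : State} (h : Ready B n K s) :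
    wp B scan (ScanResult s n K fun _ _ => True) s := by
  have h' := h
  obtain ⟨h0, h3, h2, h4, h23, hn, hK, hS⟩ := h'
  refine wp_forTo (fun j => ScanResult s n K fun x _ => x < j) (by simp [h0, hn])
    (by decide) (by decide) (by decide) (by simp [ScanResult]) ?_ ?_
  · intro j hj s₁ hj₁ hf hI
    simp only [State.setReg_reg, if_false, h0,
      show (0 : ℕ) ≠ 10 by decide] at hj
    have R₁ := ((h.of_frame (Exec.const 10 0 s).frame).of_frame hf)
    have e1 : s₁.arr 1 = s.arr 1 := hf.arr 1 rfl
    have e3 : s₁.arr 3 = s.arr 3 := hf.arr 3 rfl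
    have r5 : s₁.reg 5 = s.reg 5 := hf.reg 5 rfl
    -- The pairs seen so far are those lexicographically below `(j, i)`.
    refine wp_forTo (fun i => ScanResult s n K fun x y => x < j ∨ x = j ∧ y < i)
      (by simp [R₁.n_eq, hn]) (by decide) (by decide) (by decide) ?_ ?_ ?_
    · simpa [ScanResult] using hI
    · intro i hi s₂ hi₂ hf₂ hI₂
      rw [R₁.n_eq] at hi
      have R₂ := R₁.of_frame hf₂
      have q1 := hf₂.arr 1 rfl
      have q3 := hf₂.arr 3 rfl
      have q5 := hf₂.reg 5 rfl
      have q13 := hf₂.reg 13 rfl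
      rw [e1] at q1
      rw [e3] at q3
      rw [r5] at q5
      rw [hj₁] at q13
      refine wp_fetch (by omega) (by omega) (by rw [R₂.n_eq]; omega) fun s₃ ha₃ harr₃ hr₃ => ?_
      rw [q1, R₂.zero_eq, q13, R₂.n_eq, hi₂, Nat.zero_add] at ha₃
      have R₃ : Ready B n K s₃ := by
        refine ⟨?_, ?_, ?_, ?_, ?_, hn, hK, hS⟩ <;>
          simp [hr₃, R₂.n_eq, R₂.K_eq, R₂.zero_eq, R₂.one_eq, R₂.size_eq]
      have u5 : s₃.reg 5 = s.reg 5 := by simp [hr₃, q5]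
      have u13 : s₃.reg 13 = j := by simp [hr₃, q13]
      have u14 : s₃.reg 14 = i := by simp [hr₃, hi₂]
      have u10 : s₃.reg 10 = s₂.reg 10 := by simp [hr₃]
      have u11 : s₃.reg 11 = s₂.reg 11 := by simp [hr₃]
      have u12 : s₃.reg 12 = s₂.reg 12 := by simp [hr₃]
      have split : ∀ x y, (x < j ∨ x = j ∧ y < i + 1) ↔
          (x < j ∨ x = j ∧ y < i) ∨ (x = j ∧ y = i) := by omega
      obtain ⟨hA, hB⟩ := hI₂
      refine ⟨fun hc => ?_, fun hc => ?_⟩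
      · rw [R₃.zero_eq, ha₃] at hc
        refine wp_seq_of_frame (wp_testCovered R₃ (by omega) (by omega)) fun s₄ hf₄ hcov => ?_
        have R₄ := R₃.of_frame hf₄
        rw [harr₃, q3, u5, u13, u14] at hcov
        have v10 : s₄.reg 10 = s₂.reg 10 := (hf₄.reg 10 rfl).trans u10
        have v11 : s₄.reg 11 = s₂.reg 11 := (hf₄.reg 11 rfl).trans u11
        have v12 : s₄.reg 12 = s₂.reg 12 := (hf₄.reg 12 rfl).trans u12
        have v13 : s₄.reg 13 = j := (hf₄.reg 13 rfl).trans u13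
        have v14 : s₄.reg 14 = i := (hf₄.reg 14 rfl).trans u14
        refine ⟨fun hc' => ?_, fun hc' => ?_⟩
        · rw [R₄.zero_eq, hcov] at hc'
          intro _ _
          refine ⟨fun h10 => ?_, fun h10 x hx y hy hP h1 => ?_⟩
          · simp only [State.setReg_reg, v10, v11, v12] at h10 ⊢
            exact hA (by simpa using h10)
          · rcases (split x y).1 hP with hP | ⟨rfl, rfl⟩
            · exact hB (by simpa [v10] using h10) x hx y hy hP h1
            · exact hc'
        · rw [R₄.zero_eq, hcov] at hc'
          intro _ _
          -- A new uncovered pair overwrites an earlier one, so the last one found is reported.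
          refine ⟨fun _ => ?_, fun h10 => ?_⟩
          · simpa [v13, v14, hj, hi, hc] using hc'
          · simp at h10
      · rw [R₃.zero_eq, ha₃] at hc
        intro _ _
        refine ⟨fun h10 => ?_, fun h10 x hx y hy hP h1 => ?_⟩
        · simp [u10, u11, u12] at h10 ⊢
          exact hA h10
        · rcases (split x y).1 hP with hP | ⟨rfl, rfl⟩
          · exact hB (by simpa [u10] using h10) x hx y hy hP h1
          · exact absurd h1 hc
    · intro s₂ _ _ hI₂ _ hf₂
      rw [R₁.n_eq] at hI₂
      refine ⟨fun h10 => ?_, fun h10 x hx y hy hP h1 => ?_⟩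
      · simp at h10 ⊢
        exact hI₂.1 h10
      · exact hI₂.2 (by simpa using h10) x hx y hy (by omega) h1
  · intro s' _ _ hI
    simp only [State.setReg_reg, show (0 : ℕ) ≠ 10 by decide, if_false, h0] at hI
    exact ⟨hI.1, fun h10 x hx y hy _ h1 => hI.2 h10 x hx y hy hx h1⟩

/-- Copies the matrix at `R 5` in array `3` to the place `R b` in array `a`. -/
def copyBlock (a b : ℕ) : Prog :=
  forTo 24 23 <| .seq (.copy 22 5) <| .seq (addTo 22 24) <| .seq (.load 18 3 22) <|
    .seq (.copy 22 b) <| .seq (addTo 22 24) (.store a 22 18)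

/-- By `hab`, the writes cannot hit the source: they go to another array or start after its end.
Preservation below the target keeps the older part of the queue intact. -/
theorem wp_copyBlock {B n K a b : ℕ} {s : State} (h : Ready B n K s)
    (hab : a ≠ 3 ∨ s.reg 5 + K * n ≤ s.reg b)
    (hb1 : b ≠ 18 := by decide) (hb2 : b ≠ 20 := by decide) (hb3 : b ≠ 22 := by decide)
    (hb4 : b ≠ 24 := by decide) :
    wp B (copyBlock a b) (fun s' =>
      (∀ i < K * n, s'.arr a (s.reg b + i) = s.arr 3 (s.reg 5 + i)) ∧
      ∀ i, i < s.reg b → s'.arr a i = s.arr a i) s := by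
  obtain ⟨h0, h3, h2, h4, h23, hn, hK, hS⟩ := h
  refine wp_forTo (fun j s' => (∀ i < j, s'.arr a (s.reg b + i) = s.arr 3 (s.reg 5 + i)) ∧
      ∀ i, i < s.reg b → s'.arr a i = s.arr a i) (by simpa [h23])
    (by simp [Prog.writesReg, addTo, forTo]) (by simp [Prog.writesReg, addTo, forTo])
    (by decide) (by simp) ?_ ?_
  · rintro j hj s₁ hj₁ hf ⟨hI, hI'⟩
    have r5 : s₁.reg 5 = s.reg 5 := hf.reg 5 (by simp [Prog.writesReg, addTo, forTo])
    have rb : s₁.reg b = s.reg b :=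
      hf.reg b (by simp [Prog.writesReg, addTo, forTo, hb1, hb2, hb3, hb4])
    have e3 : s₁.arr 3 (s.reg 5 + j) = s.arr 3 (s.reg 5 + j) := by
      by_cases h3' : a = 3
      · subst h3'
        exact hI' _ (by omega)
      · rw [hf.arr 3 (by simp [Prog.writesArr, addTo, forTo, Ne.symm h3'])]
    refine wp_addTo (by simp; omega) (by decide) (by decide) (by decide) ?_
    refine wp_addTo (by simp; omega) (by decide) (by decide) (by decide) ?_
    intro _ _
    simp [hb1, hb2, hb3, r5, rb, hj₁, e3]
    refine ⟨fun i hi => ?_, fun i hi => ?_⟩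
    · rcases (Nat.le_iff_lt_or_eq.1 hi) with hi | rfl
      · simp [hi.ne, hI i hi]
      · simp
    · rw [if_neg (by omega), hI' i hi]
  · rintro s' _ _ hI
    simpa [h23] using hI

/-- Sets register `16` to `1` if row `R 15` of the matrix at `R 6` is a clique, and to `0` if
not. -/
def testClique : Prog :=
  .seq (.const 16 1) <| forTo 13 0 <| forTo 14 0 <| .seq (fetch 18 3 6 15 13) <|
    .seq (fetch 19 3 6 15 14) <| .seq (fetch 17 0 2 13 14) <|
      .branch 2 18 (.branch 2 19 (.branch 2 17 skip (.const 16 0)) skip) skip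

theorem wp_testClique {B n K : ℕ} {s : State} (h : Ready B n K s) (hl : s.reg 15 < K) :
    wp B testClique (fun s' =>
      0 < s'.reg 16 ↔ RowClique (s.arr 3) (s.arr 0) n (s.reg 6) (s.reg 15)) s := by
  have h' := h
  obtain ⟨h0, h3, h2, h4, h23, hn, hK, hS⟩ := h'
  let good (x y : ℕ) : Prop := 0 < s.arr 3 (s.reg 6 + s.reg 15 * n + x) →
    0 < s.arr 3 (s.reg 6 + s.reg 15 * n + y) → 0 < s.arr 0 (x * n + y)
  refine wp_forTo (fun j s' => 0 < s'.reg 16 ↔ ∀ x < j, ∀ y < n, good x y) (by simp [h0, hn])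
    (by decide) (by decide) (by decide) (by simp) ?_ ?_
  · intro j hj s₁ hj₁ hf hI
    simp only [State.setReg_reg, h0, show (0 : ℕ) ≠ 16 by decide, if_false] at hj
    have R₁ := ((h.of_frame (Exec.const 16 1 s).frame).of_frame hf)
    have e0 : s₁.arr 0 = s.arr 0 := hf.arr 0 rfl
    have e3 : s₁.arr 3 = s.arr 3 := hf.arr 3 rfl
    have r6 : s₁.reg 6 = s.reg 6 := hf.reg 6 rfl
    have r15 : s₁.reg 15 = s.reg 15 := hf.reg 15 rfl
    refine wp_forTo (fun i s' => 0 < s'.reg 16 ↔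
      (∀ x < j, ∀ y < n, good x y) ∧ ∀ y < i, good j y)
      (by simp [R₁.n_eq, hn]) (by decide) (by decide) (by decide) ?_ ?_ ?_
    · simpa using hI
    · intro i hi s₂ hi₂ hf₂ hI₂
      rw [R₁.n_eq] at hi
      have R₂ := R₁.of_frame hf₂
      have q0 := (hf₂.arr 0 rfl).trans e0
      have q3 := (hf₂.arr 3 rfl).trans e3
      have q6 := (hf₂.reg 6 rfl).trans r6
      have q15 := (hf₂.reg 15 rfl).trans r15
      have q13 := (hf₂.reg 13 rfl).trans hj₁
      have q0n := R₂.n_eq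
      have q2 := R₂.zero_eq
      refine wp_fetch (by omega) (by omega) (by omega) fun s₃ ha₃ harr₃ hr₃ => ?_
      refine wp_fetch (by simp [hr₃]; omega) (by simp [hr₃]; omega) (by simp [hr₃]; omega)
        fun s₄ ha₄ harr₄ hr₄ => ?_
      refine wp_fetch (by simp [hr₃, hr₄]; omega) (by simp [hr₃, hr₄]; omega)
        (by simp [hr₃, hr₄]; omega) fun s₅ ha₅ harr₅ hr₅ => ?_
      simp [hr₃, hr₄, harr₃, harr₄, q0, q3, q6, q15, q13, q0n, hi₂, q2] at ha₃ ha₄ ha₅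
      have hC : (∀ y < i + 1, good j y) ↔ (∀ y < i, good j y) ∧ good j i := by
        simp only [Nat.lt_succ_iff_lt_or_eq, or_imp, forall_and, forall_eq]
      have b18 : s₅.reg 18 = s.arr 3 (s.reg 6 + s.reg 15 * n + j) := by simp [hr₅, hr₄, ha₃]
      have b19 : s₅.reg 19 = s.arr 3 (s.reg 6 + s.reg 15 * n + i) := by simp [hr₅, ha₄]
      have b2 : s₅.reg 2 = 0 := by simp [hr₅, hr₄, hr₃, q2]
      have b16 : s₅.reg 16 = s₂.reg 16 := by simp [hr₅, hr₄, hr₃]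
      have hg : good j i ↔ (0 < s₅.reg 18 → 0 < s₅.reg 19 → 0 < s₅.reg 17) := by
        rw [b18, b19, ha₅]
      simp only [hC, ← and_assoc, ← hI₂, hg, ← b16, skip, wp, b2]
      refine ⟨fun h => ⟨fun h' => ⟨fun h'' => ?_, fun h'' => ?_⟩, fun h' => ?_⟩, fun h => ?_⟩ <;>
        intro _ _ <;> simp_all
    · intro s₂ _ _ hI₂ _ hf₂
      rw [R₁.n_eq] at hI₂
      have : (∀ x < j + 1, ∀ y < n, good x y) ↔
          (∀ x < j, ∀ y < n, good x y) ∧ ∀ y < n, good j y := by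
        simp only [Nat.lt_succ_iff_lt_or_eq, or_imp, forall_and, forall_eq]
      rw [this]
      simpa using hI₂
  · intro s' _ _ hI
    simpa [h0, RowClique] using hI

/-! ### Partial solutions in memory -/

/-- The vertex sets held by the incidence matrix number `i` in `A`, where all matrices have size
`K × n`. -/
def conf (A : ℕ → ℕ) (n K i l : ℕ) : Finset (Fin n) :=
  Finset.univ.filter fun v => 0 < A (i * (K * n) + l * n + v)

/-- The family `f` with the vertices `x` and `y` inserted into the set number `l`. -/
def insertPair {n : ℕ} (f : ℕ → Finset (Fin n)) (l : ℕ) (x y : Fin n) (l' : ℕ) : Finset (Fin n) :=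
  if l' = l then insert x (insert y (f l')) else f l'

/-- `D` is the adjacency matrix of `G` with ones on the diagonal. -/
def IsReflAdj {n : ℕ} (G : SimpleGraph (Fin n)) (D : ℕ → ℕ) : Prop :=
  ∀ x y : Fin n, 0 < D (x * n + y) ↔ x = y ∨ G.Adj x y

/-- The ones on the diagonal of `D` make the machine's test vacuous for `x = y`, where the clique
condition demands nothing. -/
theorem rowClique_iff {n K i l : ℕ} {G : SimpleGraph (Fin n)} {A D : ℕ → ℕ}
    (hD : IsReflAdj G D) :
    RowClique A D n (i * (K * n)) l ↔ G.IsClique (conf A n K i l : Set (Fin n)) := by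
  constructor
  · intro h x hx y hy hxy
    have := h x x.2 y y.2 (by simpa [conf] using hx) (by simpa [conf] using hy)
    exact ((hD x y).1 this).resolve_left hxy
  · intro h x hx y hy h1 h2
    refine (hD ⟨x, hx⟩ ⟨y, hy⟩).2 (or_iff_not_imp_left.2 fun hxy => h ?_ ?_ hxy)
    · simpa [conf] using h1
    · simpa [conf] using h2

theorem index_inj {n a b v w : ℕ} (hv : v < n) (hw : w < n) (h : a * n + v = b * n + w) :
    a = b ∧ v = w := by
  have h' : v + n * a = w + n * b := by linarith [mul_comm n a, mul_comm n b]
  have hmod := congrArg (· % n) h'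
  simp only [Nat.add_mul_mod_self_left, Nat.mod_eq_of_lt hv, Nat.mod_eq_of_lt hw] at hmod
  exact ⟨Nat.eq_of_mul_eq_mul_left (by omega) (by omega : n * a = n * b), hmod⟩

theorem entry_lt {n K l v : ℕ} (hl : l < K) (hv : v < n) : l * n + v < K * n :=
  calc l * n + v < l * n + n := by omega
    _ = (l + 1) * n := by ring
    _ ≤ K * n := Nat.mul_le_mul_right _ hl

/-- Matrix number `i < b` lies entirely below position `b * (K * n)`, so appending at slot `b` or
later does not alter it. -/
theorem conf_congr {A A' : ℕ → ℕ} {n K i l b : ℕ} (h : ∀ q < b * (K * n), A' q = A q) (hi : i < b)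
    (hl : l < K) : conf A' n K i l = conf A n K i l := by
  ext v
  have h1 := entry_lt hl v.2
  have h2 : (i + 1) * (K * n) ≤ b * (K * n) := Nat.mul_le_mul_right _ hi
  rw [add_mul] at h2
  simp [conf, h (i * (K * n) + l * n + v) (by omega)]

/-- Copies the matrix at `R 5` to `R 6`, inserts the vertices `R 11` and `R 12` into row `R 15` and
tests whether this row is a clique. -/
def makeChild : Prog :=
  .seq (copyBlock 3 6) <| .seq (put 3 6 15 11 4) <| .seq (put 3 6 15 12 4) testClique

/-- Only row `l` is tested, because the other rows are copied unchanged. The child is written to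
slot `b` even if the test fails. -/
theorem wp_makeChild {B n K i b l : ℕ} {s : State} {G : SimpleGraph (Fin n)} {x y : Fin n}
    (h : Ready B n K s) (hD : IsReflAdj G (s.arr 0)) (h5 : s.reg 5 = i * (K * n))
    (h6 : s.reg 6 = b * (K * n)) (hib : i < b) (h15 : s.reg 15 = l) (hl : l < K)
    (h11 : s.reg 11 = x) (h12 : s.reg 12 = y) :
    wp B makeChild (fun s' => (∀ q < b * (K * n), s'.arr 3 q = s.arr 3 q) ∧
      (∀ l' < K, conf (s'.arr 3) n K b l' = insertPair (conf (s.arr 3) n K i) l x y l') ∧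
      (0 < s'.reg 16 ↔
        G.IsClique (insertPair (conf (s.arr 3) n K i) l x y l : Set (Fin n)))) s := by
  have hle : i * (K * n) + K * n ≤ b * (K * n) := by
    calc i * (K * n) + K * n = (i + 1) * (K * n) := by ring
      _ ≤ _ := Nat.mul_le_mul_right _ hib
  have hK := h.K_le
  have hn := h.n_le
  have hx := x.2
  have hy := y.2
  refine wp_seq_of_frame (wp_copyBlock (a := 3) (b := 6) h (Or.inr (by rw [h5, h6]; exact hle)))
    fun s₁ hf₁ ⟨hc, hc'⟩ => ?_
  have R₁ := h.of_frame hf₁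
  have e15 := (hf₁.reg 15 rfl).trans h15
  have e11 := (hf₁.reg 11 rfl).trans h11
  have e12 := (hf₁.reg 12 rfl).trans h12
  have e6 := (hf₁.reg 6 rfl).trans h6
  have e0 := hf₁.arr 0 rfl
  rw [h5, h6] at hc
  rw [h6] at hc'
  refine wp_put (by omega) (by omega) (by rw [R₁.n_eq]; exact hn) fun s₂ ha₂ hr₂ => ?_
  refine wp_put (by simp [hr₂]; omega) (by simp [hr₂]; omega) (by simp [hr₂, R₁.n_eq, hn])
    fun s₃ ha₃ hr₃ => ?_
  have R₃ : Ready B n K s₃ := by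
    refine ⟨?_, ?_, ?_, ?_, ?_, hn, hK, h.size_le⟩ <;>
      simp [hr₃, hr₂, R₁.n_eq, R₁.K_eq, R₁.zero_eq, R₁.one_eq, R₁.size_eq]
  simp [hr₂, R₁.one_eq, R₁.n_eq, e6, e15, e11, e12] at ha₂ ha₃
  have r6 : s₃.reg 6 = b * (K * n) := by simp [hr₃, hr₂, e6]
  have r15 : s₃.reg 15 = l := by simp [hr₃, hr₂, e15]
  have a0 : s₃.arr 0 = s.arr 0 := by
    funext q
    simp [ha₃, ha₂, e0]
  have hconf : ∀ l' < K,
      conf (s₃.arr 3) n K b l' = insertPair (conf (s.arr 3) n K i) l x y l' := by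
    intro l' hl'
    -- Distinct row and vertex indices have distinct addresses, so the two writes affect only the
    -- intended entries.
    have hinj : ∀ v w : Fin n,
        b * (K * n) + l' * n + v = b * (K * n) + l * n + w ↔ l' = l ∧ v = w := by
      intro v w
      refine ⟨fun hvw => ?_, by rintro ⟨rfl, rfl⟩; rfl⟩
      have := index_inj v.2 w.2 (by omega : l' * n + v = l * n + (w : ℕ))
      exact ⟨this.1, Fin.ext this.2⟩
    ext v
    have hcopy : s₁.arr 3 (b * (K * n) + l' * n + v) = s.arr 3 (i * (K * n) + l' * n + v) := by
      rw [add_assoc, add_assoc]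
      exact hc _ (entry_lt hl' v.2)
    simp only [conf, insertPair, ha₃, ha₂, hinj, hcopy, Finset.mem_filter, Finset.mem_univ,
      true_and]
    by_cases h1 : l' = l <;> by_cases h2 : v = x <;> by_cases h3 : v = y <;> simp [*]
  have hbelow : ∀ q < b * (K * n), s₃.arr 3 q = s.arr 3 q := by
    intro q hq
    simp only [ha₃, ha₂, ← hc' q hq]
    rw [if_neg (by omega), if_neg (by omega)]
  refine wp_of_frame (wp_testClique R₃ (by rw [r15]; exact hl)) fun s₄ hf₄ h16 => ?_
  rw [hf₄.arr 3 rfl, ← hconf l hl, h16, r6, r15, rowClique_iff (by rw [a0]; exact hD)]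
  exact ⟨hbelow, hconf, Iff.rfl⟩

/-! ### Branching on an uncovered pair. -/

/-- Appends to the queue all ways of inserting the vertices `R 11` and `R 12` into a set of the
matrix at `R 5` so that this set remains a clique. -/
def expand : Prog :=
  forTo 15 3 <| .seq makeChild <| .branch 2 16 (.seq (.inc 8) (addTo 6 23)) skip

/-- The queue in `A'` is the queue of length `T` in `A` followed by `m` families. These are the
families that result from the family number `H` by inserting `x` and `y` into one of the first `j`
sets where this leads to a clique. -/
structure Expansion {n : ℕ} (G : SimpleGraph (Fin n)) (K H T : ℕ) (x y : Fin n) (A : ℕ → ℕ)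
    (j m : ℕ) (A' : ℕ → ℕ) : Prop where
  le : m ≤ j
  below : ∀ q < T * (K * n), A' q = A q
  child : ∀ i, T ≤ i → i < T + m → ∃ l < K,
    G.IsClique (insertPair (conf A n K H) l x y l : Set (Fin n)) ∧
      ∀ l' < K, conf A' n K i l' = insertPair (conf A n K H) l x y l'
  all : ∀ l < j, G.IsClique (insertPair (conf A n K H) l x y l : Set (Fin n)) →
    ∃ i, T ≤ i ∧ i < T + m ∧ ∀ l' < K, conf A' n K i l' = insertPair (conf A n K H) l x y l'

theorem wp_expand {B n K H T : ℕ} {s : State} {G : SimpleGraph (Fin n)} {x y : Fin n}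
    (h : Ready B n K s) (hD : IsReflAdj G (s.arr 0)) (h5 : s.reg 5 = H * (K * n))
    (h6 : s.reg 6 = T * (K * n)) (h8 : s.reg 8 = T) (hHT : H < T)
    (h11 : s.reg 11 = x) (h12 : s.reg 12 = y) :
    wp B expand (fun s' => ∃ m, s'.reg 8 = T + m ∧ s'.reg 6 = (T + m) * (K * n) ∧
      Expansion G K H T x y (s.arr 3) K m (s'.arr 3)) s := by
  refine wp_forTo (fun j s' => ∃ m, s'.reg 8 = T + m ∧ s'.reg 6 = (T + m) * (K * n) ∧
      Expansion G K H T x y (s.arr 3) j m (s'.arr 3)) (by rw [h.K_eq]; exact h.K_le)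
      (by decide) (by decide) (by decide) ?_ ?_ ?_
  · refine ⟨0, by simp [h8], by simp [h6], le_rfl, fun q _ => rfl, fun i hi hi' => ?_,
      fun l hl => ?_⟩ <;> omega
  · rintro j hj s₁ hj₁ hf ⟨m, h8₁, h6₁, hE⟩
    rw [h.K_eq] at hj
    have R₁ := h.of_frame hf
    have e0 := hf.arr 0 rfl
    have r5 := (hf.reg 5 rfl).trans h5
    have r11 := (hf.reg 11 rfl).trans h11
    have r12 := (hf.reg 12 rfl).trans h12
    have hhead : ∀ l < K, conf (s₁.arr 3) n K H l = conf (s.arr 3) n K H l := fun l hl =>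
      conf_congr hE.below hHT hl
    have hins : ∀ l' < K, insertPair (conf (s₁.arr 3) n K H) j x y l' =
        insertPair (conf (s.arr 3) n K H) j x y l' := fun l' hl' => by
      simp only [insertPair, hhead l' hl']
    refine wp_seq_of_frame (wp_makeChild (G := G) R₁ (by rw [e0]; exact hD) r5 h6₁ (by omega) hj₁ hj r11 r12)
      fun s₂ hf₂ ⟨hb, hc, hq⟩ => ?_
    have R₂ := R₁.of_frame hf₂
    have t8 := (hf₂.reg 8 rfl).trans h8₁
    have t6 := (hf₂.reg 6 rfl).trans h6₁
    rw [hins j hj] at hq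
    have hc' : ∀ l' < K, conf (s₂.arr 3) n K (T + m) l' =
        insertPair (conf (s.arr 3) n K H) j x y l' := fun l' hl' =>
      (hc l' hl').trans (hins l' hl')
    have hbelow : ∀ q < T * (K * n), s₂.arr 3 q = s.arr 3 q := fun q hq =>
      (hb q (hq.trans_le (Nat.mul_le_mul_right _ (by omega)))).trans (hE.below q hq)
    have hold : ∀ i < T + m, ∀ l' < K, conf (s₂.arr 3) n K i l' = conf (s₁.arr 3) n K i l' :=
      fun i hi l' hl' => conf_congr hb hi hl'
    refine ⟨fun hcl => ?_, fun hcl => ?_⟩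
    · rw [R₂.zero_eq, hq] at hcl
      refine wp_addTo (by simp [R₂.size_eq, h.size_le]) (by decide) (by decide) (by decide) ?_
      intro _ _
      refine ⟨m + 1, by simp [t8, add_assoc], by simp [t6, R₂.size_eq]; ring, ?_⟩
      simp only [State.setReg_arr]
      refine ⟨by have := hE.le; omega, hbelow, fun i hi hi' => ?_, fun l hl hcl' => ?_⟩
      · rcases Nat.lt_succ_iff_lt_or_eq.1 hi' with hi' | rfl
        · obtain ⟨l, hl, hcl', hl'⟩ := hE.child i hi hi'
          exact ⟨l, hl, hcl', fun l' h' => (hold i hi' l' h').trans (hl' l' h')⟩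
        · exact ⟨j, hj, hcl, hc'⟩
      · rcases Nat.lt_succ_iff_lt_or_eq.1 hl with hl | rfl
        · obtain ⟨i, hi, hi', h'⟩ := hE.all l hl hcl'
          exact ⟨i, hi, by omega, fun l' hl' => (hold i hi' l' hl').trans (h' l' hl')⟩
        · exact ⟨T + m, by omega, by omega, hc'⟩
    · rw [R₂.zero_eq, hq] at hcl
      -- A rejected child stays beyond the tail, outside the queue, and the next child overwrites
      -- it.
      intro _ _
      refine ⟨m, by simp [t8], by simp [t6], ?_⟩
      simp only [State.setReg_arr]
      refine ⟨by have := hE.le; omega, hbelow, fun i hi hi' => ?_, fun l hl hcl' => ?_⟩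
      · obtain ⟨l, hl, hcl', hl'⟩ := hE.child i hi hi'
        exact ⟨l, hl, hcl', fun l' h' => (hold i hi' l' h').trans (hl' l' h')⟩
      · rcases Nat.lt_succ_iff_lt_or_eq.1 hl with hl | rfl
        · obtain ⟨i, hi, hi', h'⟩ := hE.all l hl hcl'
          exact ⟨i, hi, by omega, fun l' hl' => (hold i hi' l' hl').trans (h' l' hl')⟩
        · exact absurd hcl' hcl
  · rintro s' _ _ hI
    rwa [h.K_eq] at hI

/-- Processes the first family in the queue: it is copied to array `2` if it covers all pairs, and
else the families are appended that result from covering one more pair. -/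
def processHead : Prog :=
  .seq scan <| .branch 2 10 (.seq expand <| .seq (.inc 7) (addTo 5 23))
    (.seq (copyBlock 2 2) <| .seq (.const 9 1) (.const 8 0))

/-- The family `f` covers the pair `x`, `y` by one of its first `K` sets. -/
def PairCovered {n : ℕ} (K : ℕ) (f : ℕ → Finset (Fin n)) (x y : Fin n) : Prop :=
  ∃ l < K, x ∈ f l ∧ y ∈ f l

theorem covers_iff {n K i : ℕ} {A : ℕ → ℕ} {x y : Fin n} :
    Covers A n K (i * (K * n)) x y ↔ PairCovered K (conf A n K i) x y := by
  simp [Covers, PairCovered, conf]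

/-- In the first alternative the zero in register `8` makes the test of the main loop fail, which
ends the search. -/
theorem wp_processHead {B n K H T : ℕ} {s : State} {G : SimpleGraph (Fin n)}
    (h : Ready B n K s) (hD : IsReflAdj G (s.arr 0)) (h5 : s.reg 5 = H * (K * n))
    (h6 : s.reg 6 = T * (K * n)) (h7 : s.reg 7 = H) (h8 : s.reg 8 = T) (hHT : H < T) :
    wp B processHead (fun s' =>
      (s'.reg 9 = 1 ∧ s'.reg 8 = 0 ∧
        (∀ x y : Fin n, 0 < s.arr 1 (x * n + y) → PairCovered K (conf (s.arr 3) n K H) x y) ∧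
        ∀ l < K, conf (s'.arr 2) n K 0 l = conf (s.arr 3) n K H l) ∨
      ∃ x y : Fin n, 0 < s.arr 1 (x * n + y) ∧ ¬ PairCovered K (conf (s.arr 3) n K H) x y ∧
        ∃ m, s'.reg 5 = (H + 1) * (K * n) ∧ s'.reg 6 = (T + m) * (K * n) ∧ s'.reg 7 = H + 1 ∧
          s'.reg 8 = T + m ∧ s'.reg 9 = s.reg 9 ∧
          Expansion G K H T x y (s.arr 3) K m (s'.arr 3)) s := by
  refine wp_seq_of_frame (wp_scan h) fun s₁ hf₁ hs => ?_
  have R₁ := h.of_frame hf₁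
  have e0 := hf₁.arr 0 rfl
  have e3 := hf₁.arr 3 rfl
  have r5 := (hf₁.reg 5 rfl).trans h5
  have r6 := (hf₁.reg 6 rfl).trans h6
  have r7 := (hf₁.reg 7 rfl).trans h7
  have r8 := (hf₁.reg 8 rfl).trans h8
  have r9 := hf₁.reg 9 rfl
  refine ⟨fun hc => ?_, fun hc => ?_⟩
  · rw [R₁.zero_eq] at hc
    obtain ⟨hx, hy, hxy, hcov⟩ := hs.1 hc
    rw [h5] at hcov
    refine wp_seq_of_frame (wp_expand (G := G) (x := ⟨_, hx⟩) (y := ⟨_, hy⟩) R₁ (by rw [e0]; exact hD) r5 r6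
      r8 hHT rfl rfl) fun s₂ hf₂ ⟨m, h8₂, h6₂, hE⟩ => ?_
    have R₂ := R₁.of_frame hf₂
    rw [e3] at hE
    refine wp_addTo (by simp [R₂.size_eq, h.size_le]) (by decide) (by decide) (by decide) ?_
    refine Or.inr ⟨⟨_, hx⟩, ⟨_, hy⟩, hxy, fun h' => hcov (covers_iff.2 h'), m, ?_, ?_, ?_, ?_, ?_,
      hE⟩
    · have := (hf₂.reg 5 rfl).trans r5
      simp [this, R₂.size_eq]
      ring
    · simp [h6₂]
    · simpa using (hf₂.reg 7 rfl).trans r7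
    · simp [h8₂]
    · simpa using (hf₂.reg 9 rfl).trans r9
  · rw [R₁.zero_eq] at hc
    -- Register `2` holds `0`, so the solution goes to the beginning of array `2`.
    refine wp_seq_of_frame (wp_copyBlock (a := 2) (b := 2) R₁ (Or.inl (by decide)))
      fun s₂ hf₂ ⟨h2, _⟩ => ?_
    refine Or.inl ⟨by simp, by simp, fun x y hxy => ?_, fun l hl => ?_⟩
    · have := hs.2 (by omega) x x.2 y y.2 trivial hxy
      rw [h5] at this
      exact covers_iff.1 this
    · ext v
      have := h2 _ (entry_lt hl v.2)
      rw [R₁.zero_eq, r5, e3] at this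
      simp only [zero_add] at this
      simp [conf, this, add_assoc]

/-! ### The search -/

/-- The first `K` sets of `f` are cliques of `G` that cover all pairs in `R`. -/
structure IsCliqueFamily {n : ℕ} (G : SimpleGraph (Fin n)) (R : Fin n → Fin n → Prop) (K : ℕ)
    (f : ℕ → Finset (Fin n)) : Prop where
  isClique : ∀ l < K, G.IsClique (f l : Set (Fin n))
  covers : ∀ x y, R x y → PairCovered K f x y

/-- Sum of the sizes of the first `K` sets. -/
def familySize {n : ℕ} (K : ℕ) (f : ℕ → Finset (Fin n)) : ℕ := ∑ l ∈ Finset.range K, (f l).card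

/-- Number of nodes of the `K`-ary tree of height `D - z`, and `0` if `D < z`. -/
def treeSize (K D z : ℕ) : ℕ := ∑ i ∈ Finset.range (D + 1 - z), K ^ i

theorem treeSize_anti (K D : ℕ) {z w : ℕ} (h : z ≤ w) : treeSize K D w ≤ treeSize K D z :=
  Finset.sum_le_sum_of_subset (Finset.range_mono (by omega))

/-- One root and `K` subtrees one level lower: this pays for replacing the head of the queue by its
children. -/
theorem treeSize_eq (K : ℕ) {D z : ℕ} (h : z ≤ D) :
    treeSize K D z = 1 + K * treeSize K D (z + 1) := by
  rw [treeSize, treeSize, show D + 1 - z = D + 1 - (z + 1) + 1 by omega, Finset.sum_range_succ',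
    Finset.mul_sum, add_comm]
  simp [pow_succ, mul_comm]

theorem familySize_congr {n K : ℕ} {f g : ℕ → Finset (Fin n)} (h : ∀ l < K, f l = g l) :
    familySize K f = familySize K g :=
  Finset.sum_congr rfl fun l hl => by rw [h l (Finset.mem_range.1 hl)]

theorem familySize_le {n K : ℕ} {G : SimpleGraph (Fin n)} {f : ℕ → Finset (Fin n)}
    (h : ∀ l < K, G.IsClique (f l : Set (Fin n))) : familySize K f ≤ G.cliqueNum * K := by
  calc familySize K f ≤ ∑ l ∈ Finset.range K, G.cliqueNum :=
        Finset.sum_le_sum fun l hl => (h l (Finset.mem_range.1 hl)).card_le_cliqueNum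
    _ = _ := by simp [mul_comm]

theorem subset_insertPair {n : ℕ} (f : ℕ → Finset (Fin n)) (l : ℕ) (x y : Fin n) (l' : ℕ) :
    f l' ⊆ insertPair f l x y l' := by
  unfold insertPair
  split_ifs
  · exact (Finset.subset_insert _ _).trans (Finset.subset_insert _ _)
  · exact subset_rfl

/-- Set `l` misses `x` or `y`, since otherwise it would cover the pair; hence the insertion is
strict. This bounds the depth of the tree. -/
theorem familySize_insertPair {n K l : ℕ} {f : ℕ → Finset (Fin n)} {x y : Fin n} (hl : l < K)
    (h : ¬ PairCovered K f x y) : familySize K f + 1 ≤ familySize K (insertPair f l x y) := by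
  refine Finset.sum_lt_sum (fun l' _ => Finset.card_le_card (subset_insertPair f l x y l'))
    ⟨l, Finset.mem_range.2 hl, Finset.card_lt_card ?_⟩
  refine Finset.ssubset_iff_subset_ne.2 ⟨subset_insertPair f l x y l, fun he => h ⟨l, hl, ?_⟩⟩
  constructor <;> rw [he] <;> simp [insertPair]

/-- The state during the search, with the families number `H`, …, `T - 1` in the queue, for the
budget `m` of further iterations. -/
structure Searching {n : ℕ} (G : SimpleGraph (Fin n)) (R : Fin n → Fin n → Prop) (K H T m : ℕ)
    (s : State) : Prop where
  head_base : s.reg 5 = H * (K * n)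
  tail_base : s.reg 6 = T * (K * n)
  head_eq : s.reg 7 = H
  tail_eq : s.reg 8 = T
  found_eq : s.reg 9 = 0
  head_le : H ≤ T
  isClique : ∀ i, H ≤ i → i < T → ∀ l < K, G.IsClique (conf (s.arr 3) n K i l : Set (Fin n))
  complete : ∀ f, IsCliqueFamily G R K f →
    ∃ i, H ≤ i ∧ i < T ∧ ∀ l < K, conf (s.arr 3) n K i l ⊆ f l
  budget : ∑ i ∈ Finset.Ico H T,
    treeSize K (G.cliqueNum * K) (familySize K (conf (s.arr 3) n K i)) ≤ m

/-- The search has ended with a solution in array `2`. -/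
structure Found {n : ℕ} (G : SimpleGraph (Fin n)) (R : Fin n → Fin n → Prop) (K : ℕ)
    (s : State) : Prop where
  tail_eq : s.reg 8 = 0
  found_eq : s.reg 9 = 1
  family : IsCliqueFamily G R K (conf (s.arr 2) n K 0)

/-- The loop invariant of the search. -/
structure SearchInv {n : ℕ} (G : SimpleGraph (Fin n)) (R : Fin n → Fin n → Prop) (B K m : ℕ)
    (s : State) : Prop where
  ready : Ready B n K s
  adj : IsReflAdj G (s.arr 0)
  pairs : ∀ x y : Fin n, 0 < s.arr 1 (x * n + y) ↔ R x y
  phase : Found G R K s ∨ ∃ H T, Searching G R K H T m s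

/-- If a solution `f` contains the head, some set `f l` contains both `x` and `y`. The child at `l`
is then still contained in `f`, and its enlarged set is a clique as a subset of `f l`. For the
budget, the head is exchanged for at most `K` children of strictly larger size. -/
theorem searching_expansion {n : ℕ} {G : SimpleGraph (Fin n)} {R : Fin n → Fin n → Prop}
    {K H T m j : ℕ} {s s' : State} {x y : Fin n} (hS : Searching G R K H T (m + 1) s) (hHT : H < T)
    (hR : R x y) (hxy : ¬ PairCovered K (conf (s.arr 3) n K H) x y)
    (hE : Expansion G K H T x y (s.arr 3) K j (s'.arr 3)) (h5 : s'.reg 5 = (H + 1) * (K * n))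
    (h6 : s'.reg 6 = (T + j) * (K * n)) (h7 : s'.reg 7 = H + 1) (h8 : s'.reg 8 = T + j)
    (h9 : s'.reg 9 = s.reg 9) : Searching G R K (H + 1) (T + j) m s' := by
  have hold : ∀ i < T, ∀ l < K, conf (s'.arr 3) n K i l = conf (s.arr 3) n K i l :=
    fun i hi l hl => conf_congr hE.below hi hl
  refine ⟨h5, h6, h7, h8, h9.trans hS.found_eq, by omega, ?_, ?_, ?_⟩
  · intro i hi hi' l hl
    by_cases hiT : i < T
    · rw [hold i hiT l hl]
      exact hS.isClique i (by omega) hiT l hl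
    · obtain ⟨l', hl', hcl, heq⟩ := hE.child i (by omega) hi'
      rw [heq l hl]
      by_cases hll : l = l'
      · rwa [hll]
      · simp only [insertPair, hll, if_false]
        exact hS.isClique H le_rfl hHT l hl
  · intro f hf
    obtain ⟨i, hi, hi', hsub⟩ := hS.complete f hf
    rcases eq_or_lt_of_le hi with rfl | hi
    · obtain ⟨l, hl, hx, hy⟩ := hf.covers x y hR
      have hins : ∀ l' < K, insertPair (conf (s.arr 3) n K H) l x y l' ⊆ f l' := by
        intro l' hl'
        unfold insertPair
        split_ifs with h
        · subst h
          exact Finset.insert_subset hx (Finset.insert_subset hy (hsub l' hl'))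
        · exact hsub l' hl'
      obtain ⟨i, hi, hi', heq⟩ := hE.all l hl
        ((hf.isClique l hl).subset (Finset.coe_subset.2 (hins l hl)))
      exact ⟨i, by omega, hi', fun l' hl' => (heq l' hl').trans_subset (hins l' hl')⟩
    · exact ⟨i, hi, by omega, fun l hl => (hold i hi' l hl).trans_subset (hsub l hl)⟩
  · have hb := hS.budget
    rw [Finset.sum_eq_sum_Ico_succ_bot hHT, treeSize_eq K
      (familySize_le (hS.isClique H le_rfl hHT))] at hb
    rw [← Finset.sum_Ico_consecutive _ (show H + 1 ≤ T from hHT) (Nat.le_add_right T j)]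
    have h1 : ∑ i ∈ Finset.Ico (H + 1) T,
        treeSize K (G.cliqueNum * K) (familySize K (conf (s'.arr 3) n K i)) =
        ∑ i ∈ Finset.Ico (H + 1) T,
        treeSize K (G.cliqueNum * K) (familySize K (conf (s.arr 3) n K i)) :=
      Finset.sum_congr rfl fun i hi => by
        rw [familySize_congr (hold i (Finset.mem_Ico.1 hi).2)]
    have h2 : ∑ i ∈ Finset.Ico T (T + j),
        treeSize K (G.cliqueNum * K) (familySize K (conf (s'.arr 3) n K i)) ≤
        K * treeSize K (G.cliqueNum * K) (familySize K (conf (s.arr 3) n K H) + 1) := by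
      refine (Finset.sum_le_card_nsmul _ _
        (treeSize K (G.cliqueNum * K) (familySize K (conf (s.arr 3) n K H) + 1))
        fun i hi => ?_).trans ?_
      · obtain ⟨hi, hi'⟩ := Finset.mem_Ico.1 hi
        obtain ⟨l, hl, _, heq⟩ := hE.child i hi hi'
        rw [familySize_congr heq]
        exact treeSize_anti _ _ (familySize_insertPair hl hxy)
      · simp only [Nat.card_Ico, Nat.add_sub_cancel_left, smul_eq_mul]
        exact Nat.mul_le_mul_right _ hE.le
    omega

theorem SearchInv.step {n : ℕ} {G : SimpleGraph (Fin n)} {R : Fin n → Fin n → Prop} {B K m : ℕ}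
    {s : State} (h : SearchInv G R B K m s) (hlt : s.reg 7 < s.reg 8) :
    ∃ m', m = m' + 1 ∧ wp B processHead (SearchInv G R B K m') s := by
  obtain ⟨hr, hD, hR, hF | ⟨H, T, hS⟩⟩ := h
  · rw [hF.tail_eq] at hlt
    omega
  rw [hS.head_eq, hS.tail_eq] at hlt
  -- The head alone contributes at least `1` to the sum, so the budget is not exhausted.
  obtain ⟨m', rfl⟩ : ∃ m', m = m' + 1 := by
    have hb := hS.budget
    rw [Finset.sum_eq_sum_Ico_succ_bot hlt, treeSize_eq K
      (familySize_le (hS.isClique H le_rfl hlt))] at hb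
    exact ⟨m - 1, by omega⟩
  refine ⟨m', rfl, wp_of_frame
    (wp_processHead hr hD hS.head_base hS.tail_base hS.head_eq hS.tail_eq hlt)
    fun s' hf hs' => ⟨hr.of_frame hf, by rwa [hf.arr 0 rfl], by rwa [hf.arr 1 rfl], ?_⟩⟩
  rcases hs' with ⟨h9, h8, hcov, h2⟩ | ⟨x, y, hxy, hnot, j, h5, h6, h7, h8, h9, hE⟩
  · refine Or.inl ⟨h8, h9, fun l hl => ?_, fun x y hxy => ?_⟩
    · rw [h2 l hl]
      exact hS.isClique H le_rfl hlt l hl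
    · obtain ⟨l, hl, hx⟩ := hcov x y ((hR x y).2 hxy)
      exact ⟨l, hl, by rwa [h2 l hl]⟩
  · exact Or.inr ⟨_, _, searching_expansion hS hlt ((hR x y).1 hxy) hnot hE h5 h6 h7 h8 h9⟩

/-! ### Setup -/

/-- Puts `min k (n * n)` into register `3`, sets up the constants and the queue, and marks the
diagonals of the arrays `0` and `1`. -/
def setupSearch : Prog :=
  .seq (.const 4 1) <| .seq (address 3 2 0 2) <| .seq (.branch 1 3 (.copy 3 1) skip) <|
    .seq (address 23 2 3 2) <| .seq (.copy 6 23) <| .seq (.const 8 1) <|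
      forTo 13 0 (.seq (put 0 2 13 13 4) (put 1 2 13 13 4))

/-- The matrix `A` with ones at the first `j` places of the diagonal. -/
def withDiag (A : ℕ → ℕ) (n j q : ℕ) : ℕ :=
  open Classical in if ∃ i < j, q = i * n + i then 1 else A q

theorem withDiag_succ (A : ℕ → ℕ) (n j q : ℕ) :
    withDiag A n (j + 1) q = if q = j * n + j then 1 else withDiag A n j q := by
  simp only [withDiag, Nat.lt_succ_iff_lt_or_eq, or_and_right, exists_or, exists_eq_left]
  by_cases h : q = j * n + j <;> simp [h]

theorem withDiag_pos {A : ℕ → ℕ} {n : ℕ} (x y : Fin n) :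
    0 < withDiag A n n (x * n + y) ↔ x = y ∨ 0 < A (x * n + y) := by
  have : (∃ i < n, (x * n + y : ℕ) = i * n + i) ↔ x = y := by
    constructor
    · rintro ⟨i, hi, h⟩
      obtain ⟨h1, h2⟩ := index_inj y.2 hi h
      exact Fin.ext (h1.trans h2.symm)
    · rintro rfl
      exact ⟨x, x.2, rfl⟩
  simp only [withDiag, this]
  split_ifs with h <;> simp [h]

/-- The diagonal of array `0` makes adjacency reflexive; that of array `1` demands the pairs `(v,
v)`, which encode vertex coverage. The initial queue is a single family, read off the untouched
array `3`. -/
theorem wp_setupSearch {B n k : ℕ} {s : State} (h0 : s.reg 0 = n) (h1 : s.reg 1 = k)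
    (hr : ∀ r, 1 < r → s.reg r = 0) (hn : n ≤ B) (hnn : n * n ≤ B)
    (hS : min k (n * n) * n ≤ B) :
    wp B setupSearch (fun s' => Ready B n (min k (n * n)) s' ∧
      s'.arr 0 = withDiag (s.arr 0) n n ∧ s'.arr 1 = withDiag (s.arr 1) n n ∧
      s'.arr 3 = s.arr 3 ∧ s'.reg 5 = 0 ∧ s'.reg 6 = min k (n * n) * n ∧ s'.reg 7 = 0 ∧
      s'.reg 8 = 1 ∧ s'.reg 9 = 0) s := by
  -- As register `2` is `0`, this call computes `n * n`.
  refine wp_address (by simp; omega) (by simp [hr]) (by simp; omega) fun s₁ hd₁ ha₁ hr₁ => ?_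
  simp [hr, h0] at hd₁ ha₁
  have hK : min k (n * n) ≤ B := (min_le_right _ _).trans hnn
  -- The rest of the program is treated once, for both outcomes of the comparison of `k` with `n *
  -- n`.
  have key : ∀ s₂ : State, s₂.reg 3 = min k (n * n) → s₂.arr = s.arr → s₂.reg 0 = n →
      s₂.reg 2 = 0 → s₂.reg 4 = 1 → s₂.reg 5 = 0 → s₂.reg 7 = 0 → s₂.reg 9 = 0 →
      wp B (.seq (address 23 2 3 2) <| .seq (.copy 6 23) <| .seq (.const 8 1) <|
        forTo 13 0 (.seq (put 0 2 13 13 4) (put 1 2 13 13 4)))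
      (fun s' => Ready B n (min k (n * n)) s' ∧
        s'.arr 0 = withDiag (s.arr 0) n n ∧ s'.arr 1 = withDiag (s.arr 1) n n ∧
        s'.arr 3 = s.arr 3 ∧ s'.reg 5 = 0 ∧ s'.reg 6 = min k (n * n) * n ∧ s'.reg 7 = 0 ∧
        s'.reg 8 = 1 ∧ s'.reg 9 = 0) s₂ := by
    intro s₂ e3 ea e0 e2 e4 e5 e7 e9
    refine wp_address (by omega) (by omega) (by omega) fun s₃ hd₃ ha₃ hr₃ => ?_
    rw [e2, e3, e0, Nat.zero_add, Nat.add_zero] at hd₃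
    refine wp_forTo (fun j s' => s'.arr 0 = withDiag (s.arr 0) n j ∧
      s'.arr 1 = withDiag (s.arr 1) n j) (by simp [hr₃, e0, hn]) (by decide) (by decide)
      (by decide) ?_ ?_ ?_
    · simp only [State.setReg_arr, ha₃, ea]
      constructor <;> funext q <;> simp [withDiag]
    · rintro j hj s₄ hj₄ hf ⟨hA, hA'⟩
      have g0 := hf.reg 0 rfl
      have g2 := hf.reg 2 rfl
      have g4 := hf.reg 4 rfl
      simp [hr₃, e0, e2, e4] at hj g0 g2 g4
      refine wp_put (by omega) (by omega) (by omega) fun s₅ ha₅ hr₅ => ?_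
      refine wp_put (by simp [hr₅]; omega) (by simp [hr₅]; omega) (by simp [hr₅]; omega)
        fun s₆ ha₆ hr₆ => ?_
      intro _ _
      simp [hr₅, g0, g2, g4, hj₄] at ha₅ ha₆
      constructor <;> funext q <;> simp [ha₅, ha₆, hA, hA', withDiag_succ]
    · rintro s' - hf ⟨hA, hA'⟩
      have g0 := hf.reg 0 rfl
      have g2 := hf.reg 2 rfl
      have g3 := hf.reg 3 rfl
      have g4 := hf.reg 4 rfl
      have g5 := hf.reg 5 rfl
      have g6 := hf.reg 6 rfl
      have g7 := hf.reg 7 rfl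
      have g8 := hf.reg 8 rfl
      have g9 := hf.reg 9 rfl
      have g23 := hf.reg 23 rfl
      have a3 := hf.arr 3 rfl
      simp [hr₃, hd₃, ha₃, e0, e2, e3, e4, e5, e7, e9, ea]
        at g0 g2 g3 g4 g5 g6 g7 g8 g9 g23 a3 hA hA'
      exact ⟨⟨g0, g3, g2, g4, g23, hn, hK, hS⟩, hA, hA', a3, g5, g6, g7, g8, g9⟩
  refine ⟨fun hc => ?_, fun hc => ?_⟩
  · simp [hr₁, h1, hd₁] at hc
    refine key _ ?_ ?_ ?_ ?_ ?_ ?_ ?_ ?_ <;> simp [hr₁, hr, ha₁, h0, h1, hc.le]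
  · simp [hr₁, h1, hd₁] at hc
    refine key _ ?_ ?_ ?_ ?_ ?_ ?_ ?_ ?_ <;> simp [hr₁, hr, hd₁, ha₁, h0, hc]

/-! ### Correctness and running time -/

/-- Choosing one clique for each ordered pair shows that at most `n * n` members of a solution are
needed. -/
theorem exists_family_of_solution {n k : ℕ} {G : SimpleGraph (Fin n)} {Estar : Set (Sym2 (Fin n))}
    {Cs : Finset (Finset (Fin n))} (h : IsLRCCSolution G k Estar Cs) :
    ∃ f, IsCliqueFamily G (fun x y => x = y ∨ s(x, y) ∈ Estar) (min k (n * n)) f := by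
  have hcov : ∀ p : Fin n × Fin n, ∃ C : Finset (Fin n), (p.1 = p.2 ∨ s(p.1, p.2) ∈ Estar) →
      C ∈ Cs ∧ p.1 ∈ C ∧ p.2 ∈ C := by
    rintro ⟨x, y⟩
    by_cases hp : x = y ∨ s(x, y) ∈ Estar
    · obtain ⟨C, hC, hx, hy⟩ : ∃ C ∈ Cs, x ∈ C ∧ y ∈ C := by
        rcases hp with rfl | hp
        · obtain ⟨C, hC, hx⟩ := h.covers_vertices x
          exact ⟨C, hC, hx, hx⟩
        · exact h.covers_edges x y hp
      exact ⟨C, fun _ => ⟨hC, hx, hy⟩⟩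
    · exact ⟨∅, fun h => absurd h hp⟩
  choose F hF using hcov
  -- For pairs that need no covering `F` is arbitrary; the intersection discards values outside
  -- `Cs`.
  let Ds := Cs ∩ Finset.univ.image F
  have hDs : Ds.card ≤ min k (n * n) :=
    le_min ((Finset.card_le_card Finset.inter_subset_left).trans h.card_le)
      ((Finset.card_le_card Finset.inter_subset_right).trans
        (Finset.card_image_le.trans (by simp)))
  refine ⟨fun l => if hl : l < Ds.card then (Ds.equivFin.symm ⟨l, hl⟩ : Finset (Fin n)) else ∅,
    fun l _ => ?_, fun x y hxy => ?_⟩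
  · by_cases hl : l < Ds.card
    · simp only [hl, dif_pos]
      exact h.isClique _ (Finset.mem_inter.1 (Ds.equivFin.symm ⟨l, hl⟩).2).1
    · simp [hl]
  · obtain ⟨hC, hx, hy⟩ := hF (x, y) hxy
    have hmem : F (x, y) ∈ Ds := Finset.mem_inter.2 ⟨hC, Finset.mem_image_of_mem _ (by simp)⟩
    refine ⟨Ds.equivFin ⟨_, hmem⟩, (Ds.equivFin ⟨_, hmem⟩).2.trans_le hDs, ?_⟩
    simpa using ⟨hx, hy⟩

theorem isLRCCSolution_of_family {n k K : ℕ} {G : SimpleGraph (Fin n)}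
    {Estar : Set (Sym2 (Fin n))} {f : ℕ → Finset (Fin n)}
    (h : IsCliqueFamily G (fun x y => x = y ∨ s(x, y) ∈ Estar) K f) (hK : K ≤ k) :
    IsLRCCSolution G k Estar ((Finset.range K).image f) where
  isClique := by
    simp only [Finset.mem_image, Finset.mem_range]
    rintro _ ⟨l, hl, rfl⟩
    exact h.isClique l hl
  card_le := Finset.card_image_le.trans (by simpa using hK)
  covers_vertices v := by
    obtain ⟨l, hl, hv, _⟩ := h.covers v v (Or.inl rfl)
    exact ⟨f l, Finset.mem_image_of_mem _ (Finset.mem_range.2 hl), hv⟩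
  covers_edges x y hxy := by
    obtain ⟨l, hl, hx, hy⟩ := h.covers x y (Or.inr hxy)
    exact ⟨f l, Finset.mem_image_of_mem _ (Finset.mem_range.2 hl), hx, hy⟩

/-- Writes the answer to the registers `0` and `1`. -/
def writeAnswer : Prog := .seq (.copy 1 3) (.copy 0 9)

/-- The search algorithm for Link Respected Clique Cover. -/
def lrccProg : Prog := .seq setupSearch (.seq (.loop 7 8 processHead) writeAnswer)

theorem lrccInput_pos {n k : ℕ} (G : SimpleGraph (Fin n)) (Estar : Set (Sym2 (Fin n)))
    (x y : Fin n) : (0 < (lrccInput G k Estar).arr 0 (x * n + y) ↔ G.Adj x y) ∧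
      (0 < (lrccInput G k Estar).arr 1 (x * n + y) ↔ s(x, y) ∈ Estar) := by
  have key : ∀ P : Fin n → Fin n → Prop,
      (∃ u v : Fin n, (x * n + y : ℕ) = u * n + v ∧ P u v) ↔ P x y := by
    intro P
    constructor
    · rintro ⟨u, v, he, hP⟩
      obtain ⟨h1, h2⟩ := index_inj y.2 v.2 he
      rwa [Fin.ext h1, Fin.ext h2]
    · exact fun hP => ⟨x, y, rfl, hP⟩
  have h1 := key G.Adj
  have h2 := key fun u v => s(u, v) ∈ Estar
  constructor
  · rw [← h1]
    simp only [lrccInput, if_true]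
    split_ifs with h <;> simp only [h, zero_lt_one, lt_irrefl]
  · rw [← h2]
    simp only [lrccInput, one_ne_zero, if_false, if_true]
    split_ifs with h <;> simp only [h, zero_lt_one, lt_irrefl]

theorem exec_lrccProg {n : ℕ} (G : SimpleGraph (Fin n)) (k : ℕ) (Estar : Set (Sym2 (Fin n)))
    {B : ℕ} (hn : n ≤ B) (hnn : n * n ≤ B) (hS : min k (n * n) * n ≤ B) :
    ∃ s t, Exec lrccProg (lrccInput G k Estar) s t ∧ IsLRCCAnswer G k Estar (lrccOutput n s) ∧
      t ≤ setupSearch.cost B + (treeSize (min k (n * n)) (G.cliqueNum * min k (n * n)) 0 *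
        (processHead.cost B + 1) + 1 + writeAnswer.cost B) := by
  set K := min k (n * n) with hKdef
  let R : Fin n → Fin n → Prop := fun x y => x = y ∨ s(x, y) ∈ Estar
  obtain ⟨s₁, t₁, e₁, l₁, hR₁, a0, a1, a3, r5, r6, r7, r8, r9⟩ := wp_sound
    (wp_setupSearch (s := lrccInput G k Estar) (n := n) (k := k) (by simp [lrccInput])
    (by simp [lrccInput]) (fun r hr => by simp [lrccInput, show r ≠ 0 by omega,
      show r ≠ 1 by omega]) hn hnn hS)
  have hconf : ∀ l, conf (s₁.arr 3) n K 0 l = ∅ := by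
    intro l
    rw [a3]
    simp [conf, lrccInput]
  -- The queue holds just the family of empty sets, of size `0`, so the budget is the size of the
  -- whole tree.
  have hinv : SearchInv G R B K (treeSize K (G.cliqueNum * K) 0) s₁ := by
    refine ⟨hR₁, fun x y => ?_, fun x y => ?_, Or.inr ⟨0, 1, ?_⟩⟩
    · rw [a0, withDiag_pos, (lrccInput_pos G Estar x y).1]
    · rw [a1, withDiag_pos, (lrccInput_pos G Estar x y).2]
    · refine ⟨by simpa using r5, by simpa using r6, r7, r8, r9, by omega, fun i _ hi l _ => ?_,
        fun f _ => ⟨0, le_rfl, by omega, fun l _ => by simp [hconf]⟩, ?_⟩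
      · obtain rfl : i = 0 := by omega
        simp [hconf]
      · simp [familySize, hconf]
  obtain ⟨s₂, t₂, e₂, l₂, hexit, m, hinv₂⟩ :=
    exec_loop (SearchInv G R B K) (fun m s h hlt => h.step hlt) _ s₁ hinv
  obtain ⟨s₃, t₃, e₃, l₃, hout⟩ := wp_sound (B := B) (p := writeAnswer)
    (Q := fun s' => s' = (s₂.setReg 1 (s₂.reg 3)).setReg 0 (s₂.reg 9)) (s := s₂)
    (by simp [wp, writeAnswer])
  refine ⟨s₃, _, .seq e₁ (.seq e₂ e₃), ?_, by omega⟩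
  subst hout
  obtain ⟨hR₂, -, -, hF | ⟨H, T, hS⟩⟩ := hinv₂
  · have : lrccOutput n ((s₂.setReg 1 (s₂.reg 3)).setReg 0 (s₂.reg 9)) =
        some ((Finset.range K).image (conf (s₂.arr 2) n K 0)) := by
      simp only [lrccOutput, State.setReg_reg, State.setReg_arr, hF.found_eq, hR₂.K_eq]
      simp only [one_ne_zero, if_true, if_false]
      congr 2
      funext l
      simp [conf, Nat.pos_iff_ne_zero]
    rw [this]
    exact isLRCCSolution_of_family hF.family (min_le_left _ _)
  · rw [lrccOutput, if_pos (by simp [hS.found_eq])]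
    rintro ⟨Cs, hCs⟩
    obtain ⟨f, hf⟩ := exists_family_of_solution hCs
    -- A solution would require a queued family, but the failed loop test says that the queue is
    -- empty.
    obtain ⟨i, hi, hi', _⟩ := hS.complete f hf
    rw [hS.head_eq, hS.tail_eq] at hexit
    omega

/-! ### Numerical estimates for the search tree. -/

theorem one_le_bound (b k : ℕ) :
    (1 : ℝ) ≤ (2 : ℝ) ^ ((b : ℝ) * (k : ℝ) * Real.logb 2 (k : ℝ)) := by
  have hlog : 0 ≤ Real.logb 2 (k : ℝ) := by
    -- `Real.logb 2 0 = 0`, in accordance with the convention for `k = 0`.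
    rcases Nat.eq_zero_or_pos k with rfl | hk0
    · simp
    · exact Real.logb_nonneg (by norm_num) (by exact_mod_cast hk0)
  exact Real.one_le_rpow (by norm_num) (by positivity)

/-- Each of the `b * K + 1` levels has at most `k ^ (b * k)` nodes, which is the exponential written
to base `k`. For `K = 0` only the root remains, since `0 ^ 0 = 1`. -/
theorem treeSize_le {K k b : ℕ} (hk : K ≤ k) :
    (treeSize K (b * K) 0 : ℝ) ≤
      (2 : ℝ) ^ ((b : ℝ) * (k : ℝ) * Real.logb 2 (k : ℝ)) * (b * K + 1) := by
  rcases Nat.eq_zero_or_pos K with rfl | hK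
  · simpa [treeSize] using one_le_bound b k
  have hpow : (2 : ℝ) ^ ((b : ℝ) * (k : ℝ) * Real.logb 2 (k : ℝ)) = (k : ℝ) ^ (b * k) := by
    have hk0 : (0 : ℝ) < k := by exact_mod_cast hK.trans_le hk
    rw [mul_comm, Real.rpow_mul (by norm_num), Real.rpow_logb (by norm_num) (by norm_num) hk0]
    exact_mod_cast Real.rpow_natCast (k : ℝ) (b * k)
  rw [hpow]
  have : treeSize K (b * K) 0 ≤ k ^ (b * k) * (b * K + 1) := by
    calc treeSize K (b * K) 0 ≤ ∑ i ∈ Finset.range (b * K + 1), k ^ (b * k) := by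
          refine Finset.sum_le_sum fun i hi => ?_
          have hi' : i ≤ b * k :=
            (Nat.lt_succ_iff.1 (Finset.mem_range.1 hi)).trans (Nat.mul_le_mul_left _ hk)
          exact (Nat.pow_le_pow_left hk i).trans (Nat.pow_le_pow_right (hK.trans_le hk) hi')
      _ = _ := by simp [mul_comm]
  exact_mod_cast this

end RAM

/-! ### Assembly of the running time bound. -/

theorem theorem7 :
    ∃ (P : RAM.Prog) (c : ℕ), ∀ (n : ℕ) (G : SimpleGraph (Fin n)) (k : ℕ)
      (Estar : Set (Sym2 (Fin n))), Estar ⊆ G.edgeSet →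
      ∃ (s : RAM.State) (t : ℕ),
        RAM.Exec P (lrccInput G k Estar) s t ∧
        IsLRCCAnswer G k Estar (lrccOutput n s) ∧
        (t : ℝ) ≤ (2 : ℝ) ^ ((G.cliqueNum : ℝ) * (k : ℝ) * Real.logb 2 (k : ℝ)) *
          ((c : ℝ) * ((n : ℝ) + 1) ^ c) := by
  -- This composite program is never run; it serves to bound the three costs together by one
  -- constant.
  obtain ⟨d, hd⟩ := (RAM.Prog.seq RAM.setupSearch
    (.seq RAM.processHead RAM.writeAnswer)).exists_cost_le
  -- The bound obtained is `E * (d + 2) * B ^ (d + 1)` with `B = (n + 1) ^ 3`: `B ^ d` from the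
  -- costs and one more `B` from the number of levels. The summand `6` is slack.
  refine ⟨RAM.lrccProg, 3 * (d + 1) + 6, fun n G k Estar _ => ?_⟩
  set K := min k (n * n) with hK
  -- The cube dominates both the matrix size `K * n ≤ n ^ 3` and the number `β * K + 1 ≤ n ^ 3 + 1`
  -- of levels.
  set B := (n + 1) ^ 3 with hB
  have hKn : K ≤ n * n := min_le_right _ _
  have hB1 : 1 ≤ B := Nat.one_le_pow _ _ (by omega)
  have hn : n ≤ B := by nlinarith [sq_nonneg n, Nat.zero_le (n ^ 3)]
  have hnn : n * n ≤ B := by nlinarith [sq_nonneg n, Nat.zero_le (n ^ 3)]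
  have hSB : n * n * n + 1 ≤ B := by nlinarith [sq_nonneg n]
  have hS : K * n ≤ B := by nlinarith [Nat.mul_le_mul_right n hKn]
  obtain ⟨s, t, e, hans, ht⟩ := RAM.exec_lrccProg G k Estar hn hnn hS
  refine ⟨s, t, e, hans, ?_⟩
  set E := (2 : ℝ) ^ ((G.cliqueNum : ℝ) * (k : ℝ) * Real.logb 2 (k : ℝ)) with hE
  have hE1 : 1 ≤ E := RAM.one_le_bound _ _
  have hd' := hd B hB1
  simp only [RAM.Prog.cost] at hd'
  generalize RAM.Prog.cost B RAM.setupSearch = c₁ at ht hd'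
  generalize RAM.Prog.cost B RAM.processHead = c₂ at ht hd'
  generalize RAM.Prog.cost B RAM.writeAnswer = c₃ at ht hd'
  have hb : G.cliqueNum ≤ n := by
    obtain ⟨C, hC⟩ := G.exists_isNClique_cliqueNum
    rw [← hC.card_eq]
    simpa using C.card_le_univ
  have hbK : G.cliqueNum * K + 1 ≤ B := by nlinarith [Nat.mul_le_mul hb hKn]
  have hW : (RAM.treeSize K (G.cliqueNum * K) 0 : ℝ) ≤ E * B := by
    refine (RAM.treeSize_le (min_le_left _ _)).trans ?_
    gcongr
    exact_mod_cast hbK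
  have hEB : 1 ≤ E * B := one_le_mul_of_one_le_of_one_le hE1 (by exact_mod_cast hB1)
  have ht' : (t : ℝ) ≤ c₁ + (RAM.treeSize K (G.cliqueNum * K) 0 * (c₂ + 1) + 1 + c₃) := by
    exact_mod_cast ht
  have hsum : c₁ + (c₂ + c₃) + 2 ≤ (d + 2) * B ^ d := by
    have := Nat.one_le_pow d B hB1
    rw [add_mul]
    omega
  have hn1 : (1 : ℝ) ≤ (n : ℝ) + 1 := by simp
  calc (t : ℝ) ≤ c₁ + (E * B * (c₂ + 1) + 1 + c₃) := by
        refine ht'.trans ?_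
        gcongr
    _ ≤ E * B * c₁ + (E * B * (c₂ + 1) + E * B + E * B * c₃) := by
        gcongr <;> exact le_mul_of_one_le_left (by positivity) hEB
    _ = E * B * ((c₁ + (c₂ + c₃) + 2 : ℕ) : ℝ) := by push_cast; ring
    _ ≤ E * B * (((d + 2) * B ^ d : ℕ) : ℝ) := by gcongr
    _ = E * (((d + 2 : ℕ) : ℝ) * ((n : ℝ) + 1) ^ (3 * (d + 1))) := by
        rw [hB]
        push_cast
        rw [← pow_mul, mul_add, pow_add]
        ring
    _ ≤ E * (((3 * (d + 1) + 6 : ℕ) : ℝ) * ((n : ℝ) + 1) ^ (3 * (d + 1) + 6)) := by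
        gcongr <;> omega
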